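/- An $(n,k,d,N,N_d,K)$ exact-repair regenerating code consists of encoding functions $f_i$ from the messages $\{1,\dots,N\}$ to the contents $\{1,\dots,N_d\}$ of node $i$ ($1\le i\le n$), such that the message is a function of the contents of any $k$ nodes, and such that, for every node $j$ and every set $A$ of $d$ other nodes, the content of $j$ is a function of $d$ indices in $\{1,\dots,K\}$, one computed by each node of $A$ from its own content (knowing $A$ and $j$). A pair $(\bar\alpha,\bar M)$ of reals is achievable for $(n,k,d)$ if for every $\epsilon>0$ there is such a code, with $N\ge1$ and $K\ge 2$, satisfying $\log N_d/\log K\le\bar\alpha+\epsilon$ and $\log N/\log K\ge \bar M-\epsilon$. Fix integers $\tau_1\ge\tau_2\ge 1$. For $n>\tau_1$ let $\mathcal{E}^{(n)}$ be the set of pairs $$\Big(\frac{\log(n\bar\alpha-\bar M)}{\log n},\ \frac{\log\bar M}{\log n}\Big),$$ where $(\bar\alpha,\bar M)$ is achievable for $(n,n-\tau_1,n-\tau_2)$, $\bar M>0$ and $n\bar\alpha-\bar M>0$. Let $\mathcal{E}$ be the closure of $\limsup_{n\to\infty}\mathcal{E}^{(n)}$ (the set of the pairs that lie in $\mathcal{E}^{(n)}$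 for infinitely many $n$). Let $$\mathcal{E}^*=\{(\mathsf{E}_r,\mathsf{E}_d)\in\mathbb{R}^2:\ \mathsf{E}_d\le \mathsf{E}_r+1,\ 2\mathsf{E}_d\le 2+\mathsf{E}_r,\ \mathsf{E}_d\le 2\}.$$ Complete block design codes for $(n,k,d)$ are the following. Put $t=n-d+1$, choose a block size $r$ with $t\le r\le n$, and let $T$ be the maximum over $A\subseteq\{1,\dots,n\}$ with $|A|=n-k$ of $\sum(|B\cap A|-t+1)$, summed over the $r$-subsets $B$ of $\{1,\dots,n\}$ with $|B\cap A|\ge t$. A message of $M=(r-t+1)\binom nr-T$ symbols from a finite field is extended by $T$ linear parity symbols, and the result fills, column by column, an array of $\binom nr$ columns of height $r-t+1$, one column for each $r$-subset $B$. Each column is extended by $t-1$ parity symbols to a codeword of a fixed systematic $(r,r-t+1)$ MDS code (the single parity symbol is the sum of the others if $t=2$), and the $r$ symbols of this codeword are written on the $r$ disks in $B$, one on each. To repair disk $j$ from a set $A$ of $d$ disks, for each $B\ni j$ the symbols of $r-t+1$ disks in $A\cap B$ are sent uncoded. Finitely many copies of the code are used side by side, the choices of helpers being balanced so that all $d$ helpers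 send the same number of symbols. The code must satisfy the reconstruction and repair conditions above, and $K$ may be larger than the transmitted symbols require. Theorem. (1) $\mathcal{E}=\mathcal{E}^*$. (2) The region $\mathcal{E}^*$ is asymptotically achieved by the complete block design codes: if in the definition of $\mathcal{E}$ only complete block design codes are admitted, the resulting region is again $\mathcal{E}^*$. (3) Time-sharing between the two extreme points does not achieve $\mathcal{E}^*$: if in the definition of $\mathcal{E}$ the achievable pairs for $(n,k,d)$ are replaced by the pairs $(\bar\alpha,\bar M)$ with $\bar\alpha\ge c\,\alpha_\theta$ and $\bar M\le c\,M_\theta$ for some $\theta\in[0,1]$ and $c\in(0,1]$, where $(\alpha_\theta,M_\theta)=\theta\,\big(d-k+1,\ k(d-k+1)\big)+(1-\theta)\,\big(d,\ \tfrac{k(2d-k+1)}2\big)$ is the time-sharing point between the minimum storage (MSR) and the minimum bandwidth (MBR) points, the resulting region is a proper subset of $\mathcal{E}^*$. -/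

import Mathlib

open Filter Matrix

noncomputable section

namespace Regenerating

/-- The `k`-element subsets of the `n` nodes. -/
abbrev NodeSet (n k : ℕ) : Type := {A : Finset (Fin n) // A.card = k}

/-- The possible sets of `d` helper nodes for the repair of node `j`. -/
abbrev HelperSet (n d : ℕ) (j : Fin n) : Type :=
  {A : Finset (Fin n) // j ∉ A ∧ A.card = d}

/-- An `(n, k, d, N, Nd, K)` exact-repair regenerating code: encoding, decoding,
repair-encoding and repair-decoding functions, subject to the data reconstruction
condition and the exact-repair condition. -/
structure ExactRepairCode (n k d N Nd K : ℕ) where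
  /-- `enc i` is the encoding function of node `i`. -/
  enc : Fin n → Fin N → Fin Nd
  /-- `dec A` is the decoding function of the set `A` of `k` nodes. -/
  dec : (A : NodeSet n k) → ({i // i ∈ A.1} → Fin Nd) → Fin N
  /-- `repEnc j A i` is what the helper `i ∈ A` sends when node `j` is repaired from `A`. -/
  repEnc : (j : Fin n) → (A : HelperSet n d j) → {i // i ∈ A.1} → Fin Nd → Fin K
  /-- `repDec j A` is the repair-decoding function of node `j` with the helper set `A`. -/
  repDec : (j : Fin n) → (A : HelperSet n d j) → ({i // i ∈ A.1} → Fin K) → Fin Nd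
  reconstruct : ∀ (w : Fin N) (A : NodeSet n k), dec A (fun i => enc i.1 w) = w
  repair : ∀ (w : Fin N) (j : Fin n) (A : HelperSet n d j),
    repDec j A (fun i => repEnc j A i (enc i.1 w)) = enc j w

/-- The normalized pair `(a, M)` (storage per node and message size, both in units of the
amount of data sent by one helper) is achievable for `(n, k, d)` regenerating by codes in
the class `P`.  The alphabet sizes are `N ≥ 1` and `K ≥ 2`, so that the ratios of logarithms
make sense. -/
def AchievableIn (n k d : ℕ) (P : ∀ N Nd K : ℕ, ExactRepairCode n k d N Nd K → Prop)
    (a M : ℝ) : Prop :=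
  ∀ ε : ℝ, 0 < ε → ∃ (N Nd K : ℕ) (C : ExactRepairCode n k d N Nd K),
    P N Nd K C ∧ 1 ≤ N ∧ 2 ≤ K ∧
    Real.log Nd / Real.log K ≤ a + ε ∧ M - ε ≤ Real.log N / Real.log K

/-- Achievability for `(n, k, d)` regenerating, by arbitrary exact-repair codes. -/
def Achievable (n k d : ℕ) (a M : ℝ) : Prop :=
  AchievableIn n k d (fun _ _ _ _ => True) a M

/-! ### Codes from complete block designs -/

/-- The blocks of the complete block design with block size `r` on `n` points. -/
abbrev Block (n r : ℕ) : Type := {B : Finset (Fin n) // B.card = r}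

/-- The number `T(A) = ∑ (|B ∩ A| - t + 1)`, the sum being over the blocks `B` with
`|B ∩ A| ≥ t`. -/
def lossOf (n r t : ℕ) (A : Finset (Fin n)) : ℕ :=
  ∑ B ∈ (Finset.powersetCard r (Finset.univ : Finset (Fin n))).filter
    (fun B => t ≤ (B ∩ A).card), ((B ∩ A).card - t + 1)

/-- The number `T`, the maximum of `T(A)` over the sets `A` of `n - k` nodes. -/
def loss (n k r t : ℕ) : ℕ :=
  (Finset.powersetCard (n - k) (Finset.univ : Finset (Fin n))).sup (lossOf n r t)

/-- The codeword of a systematic linear code with parity matrix `P`. -/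
def systematic {F : Type} [Field F] {m s : ℕ} (P : Matrix (Fin s) (Fin m) F)
    (u : Fin m → F) : Fin (m + s) → F :=
  Fin.append u (P *ᵥ u)

open Classical in
/-- The systematic linear code of length `m + s` and dimension `m` with parity matrix `P` is
maximum distance separable: its minimum distance reaches the Singleton bound `s + 1`. -/
def IsMDS {F : Type} [Field F] {m s : ℕ} (P : Matrix (Fin s) (Fin m) F) : Prop :=
  ∀ u : Fin m → F, u ≠ 0 → s + 1 ≤ hammingNorm (systematic P u)

/-- The ingredients of the `(n, k, d)` code over the field `F` built from the complete block
design with block size `r = m + (n - d)`; here `t = n - d + 1`, so a parity group has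
`m = r - t + 1` data symbols and `t - 1 = n - d` parity symbols.  One copy of the code carries
`M = m * choose n r - T` message symbols, and `L` copies are used side by side, to share time
among different allocations of the repair traffic to the helpers. -/
structure DesignCode (F : Type) [Field F] (n k d m M L : ℕ) where
  one_le_m : 1 ≤ m
  r_le : m + (n - d) ≤ n
  one_le_L : 1 ≤ L
  size : M + loss n k (m + (n - d)) (n - d + 1) = n.choose (m + (n - d)) * m
  /-- A numbering of the blocks. -/
  num : Block n (m + (n - d)) ≃ Fin (n.choose (m + (n - d)))
  /-- Which symbol of the parity group of `B` is written on which disk of `B`. -/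
  place : ∀ B : Block n (m + (n - d)), {x // x ∈ B.1} ≃ Fin (m + (n - d))
  /-- The parity part of the short code. -/
  P : Matrix (Fin (n - d)) (Fin m) F
  mds : IsMDS P
  /-- With a single parity symbol, that symbol is the sum of the data symbols. -/
  parity_sum : n - d = 1 → ∀ a b, P a b = 1
  /-- The parity part of the long code. -/
  S : Matrix (Fin (loss n k (m + (n - d)) (n - d + 1))) (Fin M) F
  /-- `alloc l j A B` is the set of the helpers from `A` whose symbols of the parity group of
  `B` are used in copy `l`, when node `j` is repaired. -/
  alloc : Fin L → (j : Fin n) → HelperSet n d j → Block n (m + (n - d)) → Finset (Fin n)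
  alloc_sub : ∀ l j A B, j ∈ B.1 → alloc l j A B ⊆ A.1 ∩ B.1
  alloc_card : ∀ l j A B, j ∈ B.1 → (alloc l j A B).card = m
  /-- In total, all helpers send the same number of symbols. -/
  balanced : ∀ (j : Fin n) (A : HelperSet n d j), ∀ i ∈ A.1, ∀ i' ∈ A.1,
    Nat.card {p : Fin L × Block n (m + (n - d)) // j ∈ p.2.1 ∧ i ∈ alloc p.1 j A p.2} =
    Nat.card {p : Fin L × Block n (m + (n - d)) // j ∈ p.2.1 ∧ i' ∈ alloc p.1 j A p.2}

namespace DesignCode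

variable {F : Type} [Field F] {n k d m M L : ℕ}

/-- The data symbols of the parity group of the block `B`: the message `v` followed by the
parities `S v` of the long code fills the data array column by column. -/
def data (X : DesignCode F n k d m M L) (v : Fin M → F) (B : Block n (m + (n - d))) :
    Fin m → F :=
  fun b => systematic X.S v (Fin.cast X.size.symm (finProdFinEquiv (X.num B, b)))

/-- The symbol of the parity group of `B` that is written on disk `x ∈ B`. -/
def symbol (X : DesignCode F n k d m M L) (v : Fin M → F) (B : Block n (m + (n - d)))
    (x : {x // x ∈ B.1}) : F :=
  systematic X.P (X.data v B) (X.place B x)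

/-- The content of disk `i`: for every copy and every block through `i`, one symbol. -/
def stored (X : DesignCode F n k d m M L) (i : Fin n) (v : Fin L → Fin M → F) :
    Fin L → {B : Block n (m + (n - d)) // i ∈ B.1} → F :=
  fun l B => X.symbol (v l) B.1 ⟨i, B.2⟩

/-- The stored symbols that helper `i` transmits, uncoded, for the repair of `j` from `A`. -/
def sent (X : DesignCode F n k d m M L) (j : Fin n) (A : HelperSet n d j) (i : Fin n)
    (x : Fin L → {B : Block n (m + (n - d)) // i ∈ B.1} → F) :
    {p : Fin L × Block n (m + (n - d)) // j ∈ p.2.1 ∧ i ∈ X.alloc p.1 j A p.2} → F :=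
  fun p => x p.1.1 ⟨p.1.2,
    (Finset.mem_inter.mp (X.alloc_sub p.1.1 j A p.1.2 p.2.1 p.2.2)).2⟩

end DesignCode

/-- The exact-repair code `C` is an instance of the complete block design construction over a
finite field.  Messages and disk contents are labelled bijectively by the index sets of `C`.
The transmitted symbols are labelled injectively, so that a helper may be allowed more repair
bandwidth than it needs. -/
def IsDesignCode {n k d : ℕ} (N Nd K : ℕ) (C : ExactRepairCode n k d N Nd K) : Prop :=
  ∃ (F : Type) (_ : Field F) (_ : Finite F) (m M L : ℕ) (X : DesignCode F n k d m M L)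
    (msg : Fin N ≃ (Fin L → Fin M → F))
    (disk : ∀ i : Fin n,
      Fin Nd ≃ (Fin L → {B : Block n (m + (n - d)) // i ∈ B.1} → F)),
    (∀ (i : Fin n) (w : Fin N), disk i (C.enc i w) = X.stored i (msg w)) ∧
    ∀ (j : Fin n) (A : HelperSet n d j) (i : {i // i ∈ A.1}),
      ∃ tx : ({p : Fin L × Block n (m + (n - d)) //
          j ∈ p.2.1 ∧ i.1 ∈ X.alloc p.1 j A p.2} → F) → Fin K,
        Function.Injective tx ∧
        ∀ y : Fin Nd, C.repEnc j A i y = tx (X.sent j A i.1 (disk i.1 y))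

/-- Achievability for `(n, k, d)` regenerating by the complete block design codes. -/
def AchievableByDesign (n k d : ℕ) (a M : ℝ) : Prop :=
  AchievableIn n k d (fun N Nd K C => IsDesignCode N Nd K C) a M

/-! ### Time-sharing -/

/-- `(a, M)` is covered by time-sharing, with weight `θ`, between the minimum storage point
`(d - k + 1, k (d - k + 1))` and the minimum bandwidth point `(d, k (2 d - k + 1) / 2)`.
Storage and repair bandwidth may be wasted: `c` is the fraction of the repair bandwidth that is
really used. -/
def TimeSharing (n k d : ℕ) (a M : ℝ) : Prop :=
  k ≤ d ∧ d < n ∧ ∃ θ c : ℝ, 0 ≤ θ ∧ θ ≤ 1 ∧ 0 < c ∧ c ≤ 1 ∧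
    c * (θ * ((d : ℝ) - k + 1) + (1 - θ) * d) ≤ a ∧
    M ≤ c * (θ * (k * ((d : ℝ) - k + 1)) + (1 - θ) * (k * (2 * (d : ℝ) - k + 1) / 2))

/-! ### Exponents -/

/-- The pairs (redundancy exponent, data-rate exponent) of the achievable normalized pairs
`(a, M)` with positive message size and positive redundancy. -/
def exponentPairs (ach : ℝ → ℝ → Prop) (n : ℕ) : Set (ℝ × ℝ) :=
  {p | ∃ a M : ℝ, ach a M ∧ 0 < M ∧ 0 < n * a - M ∧
    p = (Real.log (n * a - M) / Real.log n, Real.log M / Real.log n)}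

/-- The exponent region: the closure of the limit superior (the set of the points that lie in
infinitely many members of the sequence) of the sets of exponent pairs, with `k = n - τ₁` and
`d = n - τ₂`. -/
def exponentRegion (ach : ℕ → ℕ → ℕ → ℝ → ℝ → Prop) (τ₁ τ₂ : ℕ) : Set (ℝ × ℝ) :=
  closure (limsup (fun n : ℕ => exponentPairs (ach n (n - τ₁) (n - τ₂)) n) atTop)

/-- The pairs `(E_r, E_d)` with `E_d ≤ E_r + 1`, `2 E_d ≤ 2 + E_r` and `E_d ≤ 2`. -/
def Estar : Set (ℝ × ℝ) :=
  {p | p.2 ≤ p.1 + 1 ∧ 2 * p.2 ≤ 2 + p.1 ∧ p.2 ≤ 2}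

end Regenerating

end

open Filter Matrix

noncomputable section

namespace Regenerating

/-! ### The cut-set bound -/

/-! Converse. Reading `s` nodes and repairing `k - s` further ones from what new helpers send bounds
the message size (`Achievable.cutSet`). Three choices of `s` give the three sides of `Estar`
(`CutSet.bounds`): `s = 0` gives `M ≤ n ^ 2`; `s = k` gives `M ≤ (n - τ₁) a`, so the redundancy `n a
- M` is at least `a`; and `s = k - ⌊M / n⌋` makes the redundancy at least `(M / n) ^ 2 / 2`.
Constants disappear in the exponents.

Achievability. A design code with `m` data symbols per block has message size of order at least `n ^
2 / m` (once `m` exceeds a constant) and redundancy of order at most `n ^ 2 / m ^ 2`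
(`design_bounds`): the local parities dominate, and the loss `T` contributes only a bounded amount.
With `m ≈ n ^ ρ`, `0 < ρ < 1`, these exponents follow the edge `2 E_d = 2 + E_r`. Wasting bandwidth
lowers both exponents equally and wasting storage raises `E_r`, which sweeps out the interior of the
region; the closure does the rest.

Existence of the codes is a generic-position argument over a large field: the arrays invisible
outside `n - k` disks form a subspace of dimension at most `T` (`finrank_erased_le`), and a
systematic code of codimension `T` can avoid finitely many such subspaces (`exists_systematic`).
Helper loads are equalized by rotating the helpers through `d` copies (`exists_alloc`).

Time-sharing. The MSR message is only linear in `n`, and at the MBR point the redundancy is of the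
order of the message, so `E_d ≤ max 1 E_r`, which cuts off part of `Estar`. -/

/-- The cut-set bounds: `s` nodes are read directly, and `k - s` nodes are repaired. -/
def CutSet (n k d : ℕ) (a M : ℝ) : Prop :=
  k ≤ d → d < n → ∀ s ≤ k, M ≤ s * a + ∑ j ∈ Finset.Ico s k, ((d : ℝ) - j)

/-- The first `s` nodes. -/
def firstNodes (n s : ℕ) : Finset (Fin n) := Finset.univ.filter (fun i => i.1 < s)

lemma card_firstNodes {n s : ℕ} (h : s ≤ n) : (firstNodes n s).card = s := by
  simp [firstNodes, Fin.card_filter_val_lt, h]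

namespace ExactRepairCode

variable {n k d N Nd K : ℕ}

/-- Node `j` is repaired from the first `d + 1` nodes, itself excepted. -/
def firstHelpers (hdn : d < n) (j : Fin n) (hj : j.1 ≤ d) : HelperSet n d j :=
  ⟨(firstNodes n (d + 1)).erase j, by simp, by
    rw [Finset.card_erase_of_mem (by simp [firstNodes]; omega), card_firstNodes hdn]
    rfl⟩

/-- The contents of the first `s'` nodes are determined by the contents of the first `s` nodes
and, for `s ≤ j < s'`, by what `d - j` helpers send for the repair of node `j`. -/
lemma exists_flow (C : ExactRepairCode n k d N Nd K) (hdn : d < n) (s s' : ℕ) (hs : s ≤ s')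
    (hs' : s' ≤ d) :
    ∃ (X : Type) (_ : Fintype X) (f : Fin N → X),
      Fintype.card X = Nd ^ s * K ^ (∑ j ∈ Finset.Ico s s', (d - j)) ∧
      ∀ w w', f w = f w' → ∀ i : Fin n, i.1 < s' → C.enc i w = C.enc i w' := by
  induction s', hs using Nat.le_induction with
  | base =>
    refine ⟨Fin s → Fin Nd, inferInstance,
      fun w i => C.enc ⟨i.1, by omega⟩ w, by simp, fun w w' h i hi => ?_⟩
    exact congrFun h ⟨i.1, hi⟩
  | succ s' hs ih =>
    obtain ⟨X, _, f, hX, hf⟩ := ih (by omega)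
    let j : Fin n := ⟨s', by omega⟩
    let A := firstHelpers hdn j (by simp [j]; omega)
    -- Of the `d` helpers of node `s'`, nodes `0, ..., s' - 1` are already determined; only the
    -- transmissions of nodes `s' + 1, ..., d` have to be recorded.
    have hA : ∀ i : Fin (d - s'), (⟨s' + 1 + i.1, by omega⟩ : Fin n) ∈ A.1 := by
      intro i
      have := i.2
      simp only [A, firstHelpers, firstNodes, j, Finset.mem_erase, Finset.mem_filter,
        Finset.mem_univ, true_and, ne_eq, Fin.mk.injEq]
      omega
    refine ⟨X × (Fin (d - s') → Fin K), inferInstance,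
      fun w => (f w, fun i => C.repEnc j A ⟨_, hA i⟩ (C.enc ⟨s' + 1 + i.1, by omega⟩ w)), ?_, fun w w' h i hi => ?_⟩
    · rw [Fintype.card_prod, hX, Finset.sum_Ico_succ_top hs]
      simp [pow_add, mul_assoc]
    · have h1 := hf w w' (Prod.ext_iff.1 h).1
      rcases Nat.lt_succ_iff_lt_or_eq.1 hi with hi | hi
      · exact h1 i hi
      · obtain rfl : i = j := Fin.ext hi
        rw [← C.repair w j A, ← C.repair w' j A]
        congr 1
        funext x
        have hx := x.2
        simp only [A, firstHelpers, firstNodes, j, Finset.mem_erase, Finset.mem_filter,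
          Finset.mem_univ, true_and, ne_eq, Fin.ext_iff] at hx
        rcases lt_or_ge x.1.1 s' with hlt | hge
        · rw [h1 _ hlt]
        · have h2 := congrFun (Prod.ext_iff.1 h).2 ⟨x.1.1 - (s' + 1), by omega⟩
          have hxe : x = ⟨⟨s' + 1 + (x.1.1 - (s' + 1)), by omega⟩,
              hA ⟨x.1.1 - (s' + 1), by omega⟩⟩ := by
            apply Subtype.ext
            apply Fin.ext
            simp only
            omega
          rw [hxe]
          exact h2

/-- For `s' = k` the map of `exists_flow` is injective, because the first `k` nodes reconstruct the
message. -/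
lemma card_le (C : ExactRepairCode n k d N Nd K) (hkd : k ≤ d) (hdn : d < n) {s : ℕ}
    (hs : s ≤ k) : N ≤ Nd ^ s * K ^ (∑ j ∈ Finset.Ico s k, (d - j)) := by
  obtain ⟨X, _, f, hX, hf⟩ := C.exists_flow hdn s k hs hkd
  have hinj : Function.Injective f := by
    intro w w' h
    let A : NodeSet n k := ⟨firstNodes n k, card_firstNodes (by omega)⟩
    rw [← C.reconstruct w A, ← C.reconstruct w' A]
    congr 1
    funext i
    exact hf w w' h i.1 (by simpa [A, firstNodes] using i.2)
  simpa [hX] using Fintype.card_le_of_injective f hinj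

end ExactRepairCode

lemma AchievableIn.achievable {n k d : ℕ} {P : ∀ N Nd K : ℕ, ExactRepairCode n k d N Nd K → Prop}
    {a M : ℝ} (h : AchievableIn n k d P a M) : Achievable n k d a M := by
  intro ε hε
  obtain ⟨N, Nd, K, C, -, h⟩ := h ε hε
  exact ⟨N, Nd, K, C, trivial, h⟩

lemma Achievable.cutSet {n k d : ℕ} {a M : ℝ} (h : Achievable n k d a M) :
    CutSet n k d a M := by
  intro hkd hdn s hs
  refine le_of_forall_pos_le_add fun ε hε => ?_
  -- The slack enters `s` times through the storage and once through the message, hence the division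
  -- by `s + 1`.
  obtain ⟨N, Nd, K, C, -, hN, hK, h1, h2⟩ := h (ε / (s + 1)) (by positivity)
  have hlogK : 0 < Real.log K := Real.log_pos (by exact_mod_cast hK)
  have hcard := C.card_le hkd hdn hs
  have hNd : Nd ^ s ≠ 0 := by
    intro h0
    rw [h0] at hcard
    omega
  have hlog : Real.log N ≤ s * Real.log Nd + (∑ j ∈ Finset.Ico s k, (d - j) : ℕ) * Real.log K := by
    rw [← Real.log_pow, ← Real.log_pow, ← Real.log_mul (by exact_mod_cast hNd) (by positivity)]
    exact Real.log_le_log (by exact_mod_cast hN) (by exact_mod_cast hcard)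
  have hsum : ((∑ j ∈ Finset.Ico s k, (d - j) : ℕ) : ℝ) = ∑ j ∈ Finset.Ico s k, ((d : ℝ) - j) := by
    rw [Nat.cast_sum]
    refine Finset.sum_congr rfl fun j hj => ?_
    rw [Nat.cast_sub]
    have := (Finset.mem_Ico.1 hj).2
    omega
  rw [hsum] at hlog
  have h3 : Real.log N / Real.log K
      ≤ s * (Real.log Nd / Real.log K) + ∑ j ∈ Finset.Ico s k, ((d : ℝ) - j) := by
    rw [div_le_iff₀ hlogK]
    calc _ ≤ _ := hlog
      _ = _ := by field_simp
  have h4 : (s : ℝ) * (Real.log Nd / Real.log K) ≤ s * (a + ε / (s + 1)) := by gcongr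
  have h5 : s * (ε / (s + 1)) + ε / (s + 1) = ε := by field_simp
  linarith

lemma sum_Ico_sub (d k s : ℕ) (hs : s ≤ k) :
    ∑ j ∈ Finset.Ico s k, ((d : ℝ) - j) =
      ((k : ℝ) - s) * (d - k) + ((k : ℝ) - s) * (k - s + 1) / 2 := by
  induction k, hs using Nat.le_induction with
  | base => simp
  | succ k hs ih =>
    rw [Finset.sum_Ico_succ_top hs, ih]
    push_cast
    ring

/-- The three consequences of the cut-set bounds that determine the exponent region. -/
lemma CutSet.bounds {τ₁ τ₂ n : ℕ} (hτ₂ : 1 ≤ τ₂) (hτ : τ₂ ≤ τ₁) (hn : τ₁ < n) {a M : ℝ}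
    (h : CutSet n (n - τ₁) (n - τ₂) a M) (hM : 0 < M) :
    M ≤ (n : ℝ) ^ 2 ∧ M ≤ n * (n * a - M) ∧ M ^ 2 ≤ 2 * (n ^ 2 * (n * a - M)) := by
  have h := h (by omega) (by omega)
  have hk : ((n - τ₁ : ℕ) : ℝ) = n - τ₁ := by rw [Nat.cast_sub (by omega)]
  have hd : ((n - τ₂ : ℕ) : ℝ) = n - τ₂ := by rw [Nat.cast_sub (by omega)]
  have hn0 : (τ₁ : ℝ) + 1 ≤ n := by exact_mod_cast hn
  have ht2 : (1 : ℝ) ≤ τ₂ := by exact_mod_cast hτ₂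
  have ht : (τ₂ : ℝ) ≤ τ₁ := by exact_mod_cast hτ
  have h0 : M ≤ (n - τ₁ : ℝ) * (n - τ₂) := by
    have h1 := h 0 (by omega)
    rw [sum_Ico_sub _ _ _ (by omega), hk, hd] at h1
    push_cast at h1
    nlinarith
  have hka : M ≤ (n - τ₁ : ℝ) * a := by
    have h1 := h (n - τ₁) le_rfl
    simpa [hk] using h1
  have ha : 0 < a := by
    by_contra hcon
    nlinarith
  refine ⟨by nlinarith, ?_, ?_⟩
  -- The redundancy is at least `τ₁ * a`, and `τ₁ ≥ 1`.
  · have h1 : a ≤ n * a - M := by nlinarith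
    have : (n : ℝ) * a ≤ n * (n * a - M) := by gcongr
    nlinarith
  -- The cut with `s = k - l` bounds the redundancy below by about `l * a - l ^ 2 / 2`. The lower
  -- bound `b ≤ a` replaces `a`, and `l = ⌊b⌋` is then nearly optimal.
  · set b : ℝ := M / n with hb
    have hnpos : (0 : ℝ) < n := by linarith
    have hMb : M = n * b := by rw [hb]; field_simp
    have hb0 : 0 < b := by positivity
    have hba : b ≤ a := by
      rw [hb, div_le_iff₀ hnpos]
      nlinarith
    have hbk : b ≤ n - τ₁ := by
      rw [hb, div_le_iff₀ hnpos]
      nlinarith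
    set l := ⌊b⌋₊ with hl
    have hlb : (l : ℝ) ≤ b := Nat.floor_le hb0.le
    have hbl : b < l + 1 := Nat.lt_floor_add_one b
    have hlk : l ≤ n - τ₁ := by
      have : (l : ℝ) ≤ ((n - τ₁ : ℕ) : ℝ) := by rw [hk]; linarith
      exact_mod_cast this
    have h1 := h (n - τ₁ - l) (by omega)
    rw [sum_Ico_sub _ _ _ (by omega), Nat.cast_sub hlk, hk, hd] at h1
    have hl0 : (0 : ℝ) ≤ l := by positivity
    have h2 : b ^ 2 / 2 ≤ n * a - M := by
      have e1 : (τ₁ + l : ℝ) * a ≥ (τ₁ + l : ℝ) * b := by gcongr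
      -- This uses `τ₂ ≥ 1`; the spare `b / 2` pays for the rounding of `b` to `l`.
      have e2 : (l : ℝ) * (τ₁ - τ₂ + 1 / 2) ≤ b * (τ₁ - 1 / 2) := by
        apply mul_le_mul hlb <;> nlinarith
      have e3 : (l : ℝ) * l ≤ l * b := by gcongr
      have e4 : b * b ≤ (l + 1) * b := by gcongr
      nlinarith
    rw [hMb] at h2 ⊢
    have h3 : (0 : ℝ) ≤ n ^ 2 := by positivity
    nlinarith

/-- Inverting the logarithms (`log n ≠ 0` as `n ≥ 2`) forces `M = n ^ p.2` and `n * a - M = n ^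
p.1`, so positivity is automatic. -/
lemma mem_exponentPairs_iff {ach : ℝ → ℝ → Prop} {n : ℕ} (hn : 2 ≤ n) {p : ℝ × ℝ} :
    p ∈ exponentPairs ach n ↔
      ach (((n : ℝ) ^ p.1 + (n : ℝ) ^ p.2) / n) ((n : ℝ) ^ p.2) := by
  have hn1 : (1 : ℝ) < n := by exact_mod_cast hn
  have hn0 : (0 : ℝ) < n := by linarith
  have hlog : 0 < Real.log n := Real.log_pos hn1
  have key : ∀ z : ℝ, 0 < z → (n : ℝ) ^ (Real.log z / Real.log n) = z := by
    intro z hz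
    rw [Real.rpow_def_of_pos hn0, mul_div_cancel₀ _ hlog.ne', Real.exp_log hz]
  constructor
  · rintro ⟨a, M, h, hM, hR, rfl⟩
    simp only [key _ hM, key _ hR]
    convert h using 1
    field_simp
    ring
  · intro h
    refine ⟨_, _, h, by positivity, ?_, ?_⟩
    · rw [mul_div_cancel₀ _ hn0.ne']
      simp only [add_sub_cancel_right]
      positivity
    · rw [mul_div_cancel₀ _ hn0.ne', add_sub_cancel_right, Real.log_rpow hn0, Real.log_rpow hn0,
        mul_div_cancel_right₀ _ hlog.ne', mul_div_cancel_right₀ _ hlog.ne']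

/-- An inequality between powers of `n` that holds for infinitely many `n`, up to a constant,
holds between the exponents. -/
lemma exponent_le_of_frequently {x y c : ℝ}
    (h : ∃ᶠ n : ℕ in atTop, (n : ℝ) ^ y ≤ c * (n : ℝ) ^ x) : y ≤ x := by
  by_contra! hxy
  have h1 : Tendsto (fun n : ℕ => (n : ℝ) ^ (y - x)) atTop atTop :=
    (tendsto_rpow_atTop (by linarith)).comp tendsto_natCast_atTop_atTop
  refine h (((h1.eventually_gt_atTop c).and (eventually_gt_atTop 0)).mono ?_)
  rintro n ⟨h2, h3⟩
  have hn0 : (0 : ℝ) < n := by exact_mod_cast h3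
  rw [Real.rpow_sub hn0, lt_div_iff₀ (by positivity)] at h2
  linarith

lemma exponentRegion_subset {ach : ℕ → ℕ → ℕ → ℝ → ℝ → Prop} {τ₁ τ₂ : ℕ} {S : Set (ℝ × ℝ)}
    (hS : IsClosed S)
    (h : ∀ p : ℝ × ℝ, (∃ᶠ n : ℕ in atTop, ach n (n - τ₁) (n - τ₂)
      (((n : ℝ) ^ p.1 + (n : ℝ) ^ p.2) / n) ((n : ℝ) ^ p.2)) → p ∈ S) :
    exponentRegion ach τ₁ τ₂ ⊆ S := by
  refine closure_minimal (fun p hp => h p ?_) hS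
  rw [Filter.mem_limsup_iff_frequently_mem] at hp
  refine (hp.and_eventually (eventually_ge_atTop 2)).mono ?_
  rintro n ⟨h1, h2⟩
  exact (mem_exponentPairs_iff h2).1 h1

lemma isClosed_Estar : IsClosed Estar := by
  have h1 : IsClosed {p : ℝ × ℝ | p.2 ≤ p.1 + 1} := isClosed_le (by fun_prop) (by fun_prop)
  have h2 : IsClosed {p : ℝ × ℝ | 2 * p.2 ≤ 2 + p.1} := isClosed_le (by fun_prop) (by fun_prop)
  have h3 : IsClosed {p : ℝ × ℝ | p.2 ≤ 2} := isClosed_le (by fun_prop) (by fun_prop)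
  exact h1.inter (h2.inter h3)

/-- Only the cut-set bounds matter, so the same statement serves arbitrary codes, design codes and
time-sharing. -/
lemma exponentRegion_subset_Estar {ach : ℕ → ℕ → ℕ → ℝ → ℝ → Prop} {τ₁ τ₂ : ℕ} (hτ₂ : 1 ≤ τ₂)
    (hτ : τ₂ ≤ τ₁) (h : ∀ n k d a M, ach n k d a M → CutSet n k d a M) :
    exponentRegion ach τ₁ τ₂ ⊆ Estar := by
  refine exponentRegion_subset isClosed_Estar fun p hp => ?_
  have hb : ∃ᶠ n : ℕ in atTop, (0 : ℝ) < n ∧ (n : ℝ) ^ p.2 ≤ (n : ℝ) ^ 2 ∧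
      (n : ℝ) ^ p.2 ≤ n * (n : ℝ) ^ p.1 ∧
      ((n : ℝ) ^ p.2) ^ 2 ≤ 2 * (n ^ 2 * (n : ℝ) ^ p.1) := by
    refine (hp.and_eventually (eventually_gt_atTop τ₁)).mono ?_
    rintro n ⟨h1, h2⟩
    have hn0 : (0 : ℝ) < n := by exact_mod_cast (by omega : 0 < n)
    have := (h _ _ _ _ _ h1).bounds hτ₂ hτ h2 (by positivity)
    rw [mul_div_cancel₀ _ hn0.ne', add_sub_cancel_right] at this
    exact ⟨hn0, this⟩
  refine ⟨?_, ?_, ?_⟩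
  · refine exponent_le_of_frequently (c := 1) (hb.mono ?_)
    rintro n ⟨hn, -, h2, -⟩
    rwa [Real.rpow_add hn, Real.rpow_one, one_mul, mul_comm]
  · refine exponent_le_of_frequently (c := 2) (hb.mono ?_)
    rintro n ⟨hn, -, -, h3⟩
    rwa [Real.rpow_add hn, Real.rpow_two, mul_comm 2 p.2, Real.rpow_mul hn.le, Real.rpow_two]
  · refine exponent_le_of_frequently (c := 1) (hb.mono ?_)
    rintro n ⟨hn, h1, -, -⟩
    rwa [one_mul, Real.rpow_two]

/-! ### Time-sharing -/

/-- Both extreme points satisfy the bounds, which are preserved by convex combinations; scaling by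
`c ≤ 1` is harmless because the sum `W` is nonnegative. No codes at the extreme points are needed.
-/
lemma TimeSharing.cutSet {n k d : ℕ} {a M : ℝ} (h : TimeSharing n k d a M) :
    CutSet n k d a M := by
  obtain ⟨-, -, θ, c, hθ0, hθ1, hc0, hc1, ha, hM⟩ := h
  intro hkd hdn s hs
  rw [sum_Ico_sub _ _ _ hs]
  have hkd' : (k : ℝ) ≤ d := by exact_mod_cast hkd
  have hs' : (s : ℝ) ≤ k := by exact_mod_cast hs
  have hs0 : (0 : ℝ) ≤ s := by positivity
  have hsa : (s : ℝ) * (c * (θ * ((d : ℝ) - k + 1) + (1 - θ) * d)) ≤ s * a := by gcongr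
  -- The slack is `(k - s) * (k - s - 1) / 2` at the MSR point and `s * (s - 1) / 2` at the MBR
  -- point; both are nonnegative by integrality.
  have hint : ∀ u : ℕ, (0 : ℝ) ≤ (u : ℝ) * (u - 1) := by
    intro u
    rcases u with _ | u
    · simp
    · push_cast
      have : (0 : ℝ) ≤ u := by positivity
      nlinarith
  have hks := hint (k - s)
  rw [Nat.cast_sub hs] at hks
  have hss := hint s
  set W : ℝ := ((k : ℝ) - s) * (d - k) + ((k : ℝ) - s) * (k - s + 1) / 2 with hW
  have hW0 : 0 ≤ W := by
    have h1 : 0 ≤ ((k : ℝ) - s) * (d - k) := mul_nonneg (by linarith) (by linarith)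
    have h2 : 0 ≤ ((k : ℝ) - s) * (k - s + 1) := mul_nonneg (by linarith) (by linarith)
    linarith
  have hmsr : (k : ℝ) * (d - k + 1) ≤ s * (d - k + 1) + W := by
    rw [hW]
    nlinarith
  have hmbr : (k : ℝ) * (2 * d - k + 1) / 2 ≤ s * d + W := by
    rw [hW]
    nlinarith
  have h3 : θ * ((k : ℝ) * (d - k + 1)) + (1 - θ) * (k * (2 * d - k + 1) / 2) ≤
      s * (θ * ((d : ℝ) - k + 1) + (1 - θ) * d) + W := by
    have := mul_le_mul_of_nonneg_left hmsr hθ0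
    have := mul_le_mul_of_nonneg_left hmbr (sub_nonneg.2 hθ1)
    linarith
  have h4 := mul_le_mul_of_nonneg_left h3 hc0.le
  have h5 : c * W ≤ W := by nlinarith
  linarith

/-- For time-sharing, the message size is bounded linearly by the redundancy and `n`. -/
lemma TimeSharing.le {τ₁ τ₂ n : ℕ} (hτ₂ : 1 ≤ τ₂) (hτ : τ₂ ≤ τ₁) (hn : 2 * τ₁ ≤ n) {a M : ℝ}
    (h : TimeSharing n (n - τ₁) (n - τ₂) a M) : M ≤ τ₁ * n + 4 * (n * a - M) := by
  obtain ⟨-, -, θ, c, hθ0, hθ1, hc0, hc1, ha, hM⟩ := h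
  have hk : ((n - τ₁ : ℕ) : ℝ) = n - τ₁ := by rw [Nat.cast_sub (by omega)]
  have hd : ((n - τ₂ : ℕ) : ℝ) = n - τ₂ := by rw [Nat.cast_sub (by omega)]
  rw [hk, hd] at ha hM
  have hn0 : 2 * (τ₁ : ℝ) ≤ n := by exact_mod_cast hn
  have ht2 : (1 : ℝ) ≤ τ₂ := by exact_mod_cast hτ₂
  have ht : (τ₂ : ℝ) ≤ τ₁ := by exact_mod_cast hτ
  set k : ℝ := n - τ₁ with hkdef
  set d : ℝ := n - τ₂ with hddef
  have hna := mul_le_mul_of_nonneg_left ha (by positivity : (0 : ℝ) ≤ n)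
  have hmsr : k * (d - k + 1) ≤ τ₁ * n + 4 * (n * (d - k + 1) - k * (d - k + 1)) := by
    rw [hkdef, hddef]
    nlinarith
  -- Here message and redundancy are both about `n ^ 2 / 2`; the factor `4` leaves room to use only
  -- `d ≤ 2 * k`.
  have hmbr : k * (2 * d - k + 1) / 2 ≤ τ₁ * n + 4 * (n * d - k * (2 * d - k + 1) / 2) := by
    have h1 : d ≤ 2 * k := by linarith
    have h2 : 0 ≤ k * (2 * k - d) := mul_nonneg (by linarith) (by linarith)
    have h3 : (n : ℝ) = k + τ₁ := by linarith
    rw [h3]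
    nlinarith
  have h1 := mul_le_mul_of_nonneg_left hmsr hθ0
  have h2 := mul_le_mul_of_nonneg_left hmbr (sub_nonneg.2 hθ1)
  have h3 := mul_le_mul_of_nonneg_left (add_le_add h1 h2) hc0.le
  have h4 : c * (τ₁ * n) ≤ 1 * (τ₁ * n) := by gcongr
  nlinarith

/-- Time-sharing never has a data rate of higher order than `max (1, redundancy)`. -/
lemma exponentRegion_timeSharing_subset {τ₁ τ₂ : ℕ} (hτ₂ : 1 ≤ τ₂) (hτ : τ₂ ≤ τ₁) :
    exponentRegion TimeSharing τ₁ τ₂ ⊆ {p | p.2 ≤ max 1 p.1} := by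
  refine exponentRegion_subset (isClosed_le (by fun_prop) (by fun_prop)) fun p hp => ?_
  refine exponent_le_of_frequently (c := τ₁ + 4)
    ((hp.and_eventually (eventually_ge_atTop (2 * τ₁))).mono ?_)
  rintro n ⟨h1, h2⟩
  have hn1 : (1 : ℝ) ≤ n := by exact_mod_cast (by omega : 1 ≤ n)
  have h3 := h1.le hτ₂ hτ h2
  rw [mul_div_cancel₀ _ (by positivity), add_sub_cancel_right] at h3
  have h4 : (n : ℝ) ≤ (n : ℝ) ^ (max 1 p.1) := by
    conv_lhs => rw [← Real.rpow_one (n : ℝ)]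
    exact Real.rpow_le_rpow_of_exponent_le hn1 (le_max_left _ _)
  have h5 : (n : ℝ) ^ p.1 ≤ (n : ℝ) ^ (max 1 p.1) :=
    Real.rpow_le_rpow_of_exponent_le hn1 (le_max_right _ _)
  have h6 : (τ₁ : ℝ) * n ≤ τ₁ * (n : ℝ) ^ (max 1 p.1) := by gcongr
  linarith

/-- The point `(1, 3 / 2)` of `Estar` violates `E_d ≤ max 1 E_r`. -/
lemma exponentRegion_timeSharing_ssubset {τ₁ τ₂ : ℕ} (hτ₂ : 1 ≤ τ₂) (hτ : τ₂ ≤ τ₁) :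
    exponentRegion TimeSharing τ₁ τ₂ ⊂ Estar := by
  refine ⟨exponentRegion_subset_Estar hτ₂ hτ fun _ _ _ _ _ h => h.cutSet, fun h => ?_⟩
  have h1 : ((1 : ℝ), (3 / 2 : ℝ)) ∈ Estar := by
    refine ⟨?_, ?_, ?_⟩ <;> norm_num
  have h2 := exponentRegion_timeSharing_subset hτ₂ hτ (h h1)
  norm_num at h2

/-! ### Counting blocks -/

lemma card_blocks_through {n r : ℕ} (hr : 1 ≤ r) (i : Fin n) :
    Nat.card {B : Block n r // i ∈ B.1} = (n - 1).choose (r - 1) := by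
  have h := Finset.card_filter_powersetCard_subset {i} (Finset.univ : Finset (Fin n)) r
    (by simp) (by simpa using hr)
  simp only [Finset.card_univ, Fintype.card_fin, Finset.card_singleton] at h
  rw [← h, ← Fintype.card_coe, ← Nat.card_eq_fintype_card]
  refine Nat.card_congr ((Equiv.subtypeSubtypeEquivSubtypeInter (fun B : Finset (Fin n) =>
    B.card = r) (fun B => i ∈ B)).trans (Equiv.subtypeEquivRight fun B => ?_))
  simp [Finset.mem_powersetCard]

lemma card_block (n r : ℕ) : Nat.card (Block n r) = n.choose r := by
  simp

/-- Truncated subtraction gives `0` on the blocks that the filter excludes. -/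
lemma lossOf_eq {n r t : ℕ} (ht : 1 ≤ t) (A : Finset (Fin n)) :
    lossOf n r t A = ∑ B ∈ Finset.powersetCard r (Finset.univ : Finset (Fin n)),
      ((B ∩ A).card - (t - 1)) := by
  rw [lossOf, Finset.sum_filter]
  refine Finset.sum_congr rfl fun B _ => ?_
  split_ifs <;> omega

/-- A block loses at most its `m` data symbols. Hence the subtraction that defines the message
length is never truncated. -/
lemma loss_le_mul {n k m s : ℕ} : loss n k (m + s) (s + 1) ≤ n.choose (m + s) * m := by
  refine Finset.sup_le fun A _ => ?_
  rw [lossOf_eq (by omega)]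
  refine (Finset.sum_le_card_nsmul _ _ m fun B hB => ?_).trans ?_
  · have h1 := (Finset.mem_powersetCard.1 hB).2
    have h2 := Finset.card_le_card (Finset.inter_subset_left : B ∩ A ⊆ B)
    omega
  · simp

/-- A disk set of size `n - k` loses at most one symbol for each of its pairs of disks and each
block through that pair. -/
lemma loss_le {n k r t : ℕ} (ht : 2 ≤ t) (hr : 2 ≤ r) :
    loss n k r t ≤ (n - k).choose 2 * (n - 2).choose (r - 2) := by
  refine Finset.sup_le fun A hA => ?_
  have hA' := (Finset.mem_powersetCard.1 hA).2
  rw [lossOf_eq (by omega)]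
  calc _ ≤ ∑ B ∈ Finset.powersetCard r (Finset.univ : Finset (Fin n)),
        ∑ Q ∈ Finset.powersetCard 2 A, if Q ⊆ B then 1 else 0 := by
        refine Finset.sum_le_sum fun B _ => ?_
        rw [← Finset.sum_filter, ← Finset.card_eq_sum_ones]
        have h1 : Finset.powersetCard 2 (B ∩ A) ⊆
            (Finset.powersetCard 2 A).filter (fun Q => Q ⊆ B) := by
          intro Q hQ
          rw [Finset.mem_powersetCard, Finset.subset_inter_iff] at hQ
          simp [Finset.mem_powersetCard, hQ]
        refine le_trans ?_ (Finset.card_le_card h1)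
        rw [Finset.card_powersetCard]
        -- As `t ≥ 2`, the block loses at most `e - 1 ≤ choose e 2` symbols.
        generalize (B ∩ A).card = e
        rcases e with _ | e
        · omega
        · rw [Nat.choose_succ_succ' e 1, Nat.choose_one_right]
          omega
    _ = ∑ Q ∈ Finset.powersetCard 2 A, (n - 2).choose (r - 2) := by
        rw [Finset.sum_comm]
        refine Finset.sum_congr rfl fun Q hQ => ?_
        have hQ' := (Finset.mem_powersetCard.1 hQ).2
        rw [← Finset.sum_filter, ← Finset.card_eq_sum_ones,
          Finset.card_filter_powersetCard_subset Q _ r (by simp) (by omega)]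
        simp [hQ']
    _ = _ := by simp [hA']

/-! ### Generic systematic codes -/

section Generic

variable {F : Type} [Field F]

/-- Few proper subspaces do not cover a vector space over a finite field. -/
lemma exists_forall_notMem [Finite F] {ι : Type} [Finite ι] {V : Type} [AddCommGroup V]
    [Module F V] [FiniteDimensional F V]
    (U : ι → Submodule F V) (hU : ∀ i, U i ≠ ⊤) (hι : Nat.card ι < Nat.card F) :
    ∃ x, ∀ i, x ∉ U i := by
  classical
  cases nonempty_fintype ι
  cases nonempty_fintype F
  have : Finite V := Module.finite_of_finite F
  cases nonempty_fintype V
  by_contra! hcon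
  have hcov : (Finset.univ : Finset V) ⊆
      Finset.univ.biUnion (fun i => Finset.univ.filter (fun x => x ∈ U i)) := by
    intro x _
    obtain ⟨i, hi⟩ := hcon x
    simpa using ⟨i, hi⟩
  have hcard := (Finset.card_le_card hcov).trans Finset.card_biUnion_le
  have hq : ∀ i, Fintype.card F * (Finset.univ.filter (fun x => x ∈ U i)).card
      ≤ Fintype.card V := by
    intro i
    rw [← Fintype.card_subtype, Module.card_eq_pow_finrank (K := F) (V := V)]
    have h1 : Fintype.card {x // x ∈ U i} = Fintype.card F ^ Module.finrank F (U i) :=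
      Module.card_eq_pow_finrank
    rw [h1, ← pow_succ']
    exact Nat.pow_le_pow_right Fintype.card_pos (Submodule.finrank_lt (hU i))
  have h2 : Fintype.card F * Fintype.card V ≤ Fintype.card ι * Fintype.card V :=
    calc _ ≤ Fintype.card F * ∑ i, (Finset.univ.filter (fun x => x ∈ U i)).card :=
          Nat.mul_le_mul_left _ (by simpa using hcard)
      _ ≤ ∑ _i : ι, Fintype.card V := by
          rw [Finset.mul_sum]
          exact Finset.sum_le_sum fun i _ => hq i
      _ = _ := by simp
  have h3 := Nat.le_of_mul_le_mul_right h2 Fintype.card_pos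
  simp only [Nat.card_eq_fintype_card] at hι
  omega

/-- Vectors that are independent modulo each of a few subspaces of small dimension. -/
lemma exists_independent_mod [Finite F] {ι : Type} [Finite ι] {V : Type} [AddCommGroup V]
    [Module F V] [FiniteDimensional F V]
    (U : ι → Submodule F V) {M T : ℕ} (hU : ∀ i, Module.finrank F (U i) ≤ T)
    (hMT : M + T ≤ Module.finrank F V) (hι : Nat.card ι < Nat.card F) :
    ∃ v : Fin M → V, ∀ i (c : Fin M → F), ∑ j, c j • v j ∈ U i → c = 0 := by
  induction M with
  | zero => exact ⟨Fin.elim0, fun i c _ => Subsingleton.elim _ _⟩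
  | succ M ih =>
    obtain ⟨v, hv⟩ := ih (by omega)
    -- Each `U i` plus the span of the earlier vectors has dimension at most `T + M`, hence is
    -- proper.
    obtain ⟨x, hx⟩ := exists_forall_notMem (fun i => U i ⊔ Submodule.span F (Set.range v))
      (fun i htop => by
        have h1 := Submodule.finrank_add_le_finrank_add_finrank (U i)
          (Submodule.span F (Set.range v))
        have h2 : Module.finrank F (Submodule.span F (Set.range v)) ≤ M := by
          exact (finrank_range_le_card (R := F) v).trans (by simp)
        have h3 := hU i
        rw [htop, finrank_top] at h1
        omega) hι
    refine ⟨Fin.cons x v, fun i c hc => ?_⟩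
    simp only [Fin.sum_univ_succ, Fin.cons_zero, Fin.cons_succ] at hc
    have hspan : ∑ j : Fin M, c j.succ • v j ∈ Submodule.span F (Set.range v) :=
      Submodule.sum_mem _ fun j _ =>
        Submodule.smul_mem _ _ (Submodule.subset_span (Set.mem_range_self j))
    have hc0 : c 0 = 0 := by
      by_contra hne
      refine hx i ?_
      have h4 : c 0 • x ∈ U i ⊔ Submodule.span F (Set.range v) := by
        have := Submodule.sub_mem _ (Submodule.mem_sup_left hc)
          (Submodule.mem_sup_right (S := U i) hspan)
        simpa using this
      exact (Submodule.smul_mem_iff _ hne).1 h4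
    rw [hc0, zero_smul, zero_add] at hc
    have h5 := hv i (fun j => c j.succ) hc
    funext j
    refine Fin.cases hc0 (fun j => congrFun h5 j) j

/-- The encoder of a systematic code, as a linear map. -/
def systematicLin {m s : ℕ} (P : Matrix (Fin s) (Fin m) F) :
    (Fin m → F) →ₗ[F] (Fin (m + s) → F) where
  toFun := systematic P
  map_add' u v := by
    funext x
    refine Fin.addCases (fun i => ?_) (fun i => ?_) x <;> simp [systematic, Matrix.mulVec_add]
  map_smul' c u := by
    funext x
    refine Fin.addCases (fun i => ?_) (fun i => ?_) x <;> simp [systematic, Matrix.mulVec_smul]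

lemma systematic_sub {m s : ℕ} (P : Matrix (Fin s) (Fin m) F) (u v : Fin m → F) :
    systematic P (u - v) = systematic P u - systematic P v :=
  (systematicLin P).map_sub u v

/-- A systematic code that meets each of a few subspaces of small dimension trivially. -/
lemma exists_systematic [Finite F] {ι : Type} [Finite ι] {M T : ℕ}
    (U : ι → Submodule F (Fin (M + T) → F))
    (hU : ∀ i, Module.finrank F (U i) ≤ T) (hι : Nat.card ι + 1 < Nat.card F) :
    ∃ S : Matrix (Fin T) (Fin M) F, ∀ i v, systematic S v ∈ U i → v = 0 := by
  let π₁ : (Fin (M + T) → F) →ₗ[F] (Fin M → F) := LinearMap.funLeft F F (Fin.castAdd T)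
  let π₂ : (Fin (M + T) → F) →ₗ[F] (Fin T → F) := LinearMap.funLeft F F (Fin.natAdd M)
  have hker : Module.finrank F (LinearMap.ker π₁) ≤ T := by
    have := LinearMap.finrank_le_finrank_of_injective (f := π₂ ∘ₗ (LinearMap.ker π₁).subtype) (by
      rw [← LinearMap.ker_eq_bot, LinearMap.ker_eq_bot']
      rintro ⟨x, hx⟩ hx2
      have hx1 : π₁ x = 0 := hx
      have hx2 : π₂ x = 0 := hx2
      apply Subtype.ext
      funext y
      refine Fin.addCases (fun i => ?_) (fun i => ?_) y
      · exact congrFun hx1 i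
      · exact congrFun hx2 i)
    simpa using this
  -- The extra subspace `ker π₁` (the `+ 1` in `hι`) makes the projection of the code to its first
  -- `M` coordinates bijective, so that reparametrizing makes the code systematic.
  obtain ⟨v, hv⟩ := exists_independent_mod (M := M) (T := T)
    (fun o : Option ι => o.elim (LinearMap.ker π₁) U)
    (fun o => by
      cases o
      · exact hker
      · exact hU _) (by simp) (by
      rw [Finite.card_option]
      exact hι)
  let φ : (Fin M → F) →ₗ[F] (Fin (M + T) → F) := Fintype.linearCombination F v
  have hφ : ∀ c, φ c = ∑ j, c j • v j := fun c => Fintype.linearCombination_apply F v c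
  have hinj : Function.Injective (π₁ ∘ₗ φ) := by
    rw [← LinearMap.ker_eq_bot, LinearMap.ker_eq_bot']
    intro c hc
    refine hv none c ?_
    rw [← hφ]
    exact hc
  let e : (Fin M → F) ≃ₗ[F] (Fin M → F) := LinearEquiv.ofInjectiveEndo _ hinj
  have he : ∀ c, e c = π₁ (φ c) := fun c => rfl
  refine ⟨LinearMap.toMatrix' (π₂ ∘ₗ φ ∘ₗ e.symm.toLinearMap), fun i u hu => ?_⟩
  have h1 : systematic (LinearMap.toMatrix' (π₂ ∘ₗ φ ∘ₗ e.symm.toLinearMap)) u =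
      φ (e.symm u) := by
    funext y
    rw [systematic]
    refine Fin.addCases (fun i => ?_) (fun i => ?_) y
    · rw [Fin.append_left]
      have h2 := congrFun (he (e.symm u)) i
      rw [e.apply_symm_apply] at h2
      exact h2
    · rw [Fin.append_right, LinearMap.toMatrix'_mulVec]
      rfl
  rw [h1, hφ] at hu
  have h3 := hv (some i) _ hu
  simpa using h3

/-- A nonzero codeword of weight at most `s` would vanish on `m` coordinates. -/
lemma isMDS_of_forall {m s : ℕ} {P : Matrix (Fin s) (Fin m) F}
    (h : ∀ I : Finset (Fin (m + s)), I.card = m → ∀ u, (∀ i ∈ I, systematic P u i = 0) → u = 0) :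
    IsMDS P := by
  classical
  intro u hu
  by_contra! hlt
  have h1 := Finset.card_filter_add_card_filter_not (s := Finset.univ)
    (fun i => systematic P u i = 0)
  simp only [Finset.card_univ, Fintype.card_fin] at h1
  have h2 : hammingNorm (systematic P u) =
      (Finset.univ.filter (fun i => ¬ systematic P u i = 0)).card := by
    rw [hammingNorm]
  obtain ⟨I, hI, hIm⟩ := Finset.exists_subset_card_eq
    (s := Finset.univ.filter (fun i => systematic P u i = 0)) (n := m) (by
      have : hammingNorm (systematic P u) < s + 1 := by convert hlt
      omega)
  exact hu (h I hIm u fun i hi => by simpa using hI hi)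

lemma IsMDS.eq_zero {m s : ℕ} {P : Matrix (Fin s) (Fin m) F} (h : IsMDS P)
    {I : Finset (Fin (m + s))} (hI : m ≤ I.card) {u : Fin m → F}
    (hu : ∀ i ∈ I, systematic P u i = 0) : u = 0 := by
  classical
  by_contra hne
  have h0 := h u hne
  have h1 := Finset.card_filter_add_card_filter_not (s := Finset.univ)
    (fun i => systematic P u i = 0)
  simp only [Finset.card_univ, Fintype.card_fin] at h1
  have h2 : s + 1 ≤ (Finset.univ.filter (fun i => ¬ systematic P u i = 0)).card := by
    rw [hammingNorm] at h0
    convert h0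
  have h3 : I ⊆ Finset.univ.filter (fun i => systematic P u i = 0) := by
    intro i hi
    simpa using hu i hi
  have h4 := Finset.card_le_card h3
  omega

lemma isMDS_one {m : ℕ} {P : Matrix (Fin 1) (Fin m) F} (hP : ∀ a b, P a b = 1) : IsMDS P := by
  classical
  refine isMDS_of_forall fun I hI u hu => ?_
  have hIc : Iᶜ.card = 1 := by
    rw [Finset.card_compl, hI]
    simp
  obtain ⟨z, hz⟩ := Finset.card_eq_one.1 hIc
  have hu' : ∀ i, i ≠ z → systematic P u i = 0 := by
    intro i hi
    refine hu i ?_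
    by_contra hiI
    have : i ∈ Iᶜ := Finset.mem_compl.2 hiI
    rw [hz] at this
    exact hi (Finset.mem_singleton.1 this)
  by_contra hne
  obtain ⟨b, hb⟩ := Function.ne_iff.1 hne
  have hbz : Fin.castAdd 1 b = z := by
    by_contra hbz
    have := hu' _ hbz
    simp only [systematic, Fin.append_left] at this
    exact hb this
  have h1 : ∀ b' ≠ b, u b' = 0 := by
    intro b' hb'
    have := hu' (Fin.castAdd 1 b') (by rw [← hbz]; simpa using hb')
    simpa only [systematic, Fin.append_left] using this
  have h2 := hu' (Fin.natAdd m 0) (by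
    rw [← hbz]
    intro h
    have := congrArg Fin.val h
    simp at this
    omega)
  simp only [systematic, Fin.append_right, Matrix.mulVec, dotProduct, hP, one_mul] at h2
  rw [Finset.sum_eq_single b (fun b' _ hb' => h1 b' hb') (by simp)] at h2
  exact hb h2

/-- For `s = 1` the parity must be the plain sum. Otherwise the code has to avoid, for each `m`-set
of coordinates, the `s`-dimensional space of words vanishing there. -/
lemma exists_isMDS [Finite F] {m s : ℕ} (hF : 2 ^ (m + s) + 1 < Nat.card F) :
    ∃ P : Matrix (Fin s) (Fin m) F, IsMDS P ∧ (s = 1 → ∀ a b, P a b = 1) := by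
  by_cases hs : s = 1
  · subst hs
    exact ⟨fun _ _ => 1, isMDS_one fun _ _ => rfl, fun _ _ _ => rfl⟩
  · let res : Finset (Fin (m + s)) → Submodule F (Fin (m + s) → F) := fun I =>
      LinearMap.ker (LinearMap.funLeft F F (Subtype.val : I → Fin (m + s)))
    obtain ⟨P, hP⟩ := exists_systematic
      (ι := {I : Finset (Fin (m + s)) // I.card = m}) (fun I => res I.1) (fun I => by
        have h1 := LinearMap.finrank_range_add_finrank_ker
          (LinearMap.funLeft F F (Subtype.val : I.1 → Fin (m + s)))
        rw [LinearMap.range_eq_top.2 (LinearMap.funLeft_surjective_of_injective _ _ _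
          Subtype.val_injective), finrank_top] at h1
        simp only [Module.finrank_fintype_fun_eq_card, Fintype.card_coe, Fintype.card_fin,
          I.2] at h1
        exact (Nat.add_left_cancel h1).le) (by
        refine lt_of_le_of_lt (Nat.add_le_add_right ?_ 1) hF
        refine (Finite.card_subtype_le _).trans ?_
        simp)
    refine ⟨P, isMDS_of_forall fun I hI u hu => hP ⟨I, hI⟩ u ?_, fun h => (hs h).elim⟩
    rw [LinearMap.mem_ker]
    funext i
    exact hu i.1 i.2

end Generic

/-! ### Balanced allocations of the repair traffic -/

/-- A sharply transitive family of permutations of `A`, extended by the identity. -/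
lemma exists_rotations {n d : ℕ} (hd : 1 ≤ d) (A : Finset (Fin n)) (hA : A.card = d) :
    ∃ ρ : Fin d → Equiv.Perm (Fin n), (∀ l, ∀ x ∉ A, ρ l x = x) ∧ (∀ l, ∀ x ∈ A, ρ l x ∈ A) ∧
      ∀ x ∈ A, ∀ y ∈ A, ∃! l, ρ l x = y := by
  classical
  have : NeZero d := ⟨by omega⟩
  let e : {x // x ∈ A} ≃ Fin d := Finset.equivFinOfCardEq hA
  let σ : Fin d → Equiv.Perm {x // x ∈ A} := fun l => (e.trans (Equiv.addRight l)).trans e.symm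
  have hσ : ∀ l (x : {x // x ∈ A}), (Equiv.Perm.ofSubtype (σ l)) x.1 = (σ l x).1 :=
    fun l x => Equiv.Perm.ofSubtype_apply_coe (σ l) x
  refine ⟨fun l => Equiv.Perm.ofSubtype (σ l),
    fun l x hx => Equiv.Perm.ofSubtype_apply_of_not_mem (σ l) hx, fun l x hx => ?_,
    fun x hx y hy => ⟨e ⟨y, hy⟩ - e ⟨x, hx⟩, ?_, fun l hl => ?_⟩⟩
  · have := hσ l ⟨x, hx⟩
    simp only at this
    rw [this]
    exact (σ l ⟨x, hx⟩).2
  · have := hσ (e ⟨y, hy⟩ - e ⟨x, hx⟩) ⟨x, hx⟩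
    simp only at this ⊢
    rw [this]
    simp [σ]
  · have := hσ l ⟨x, hx⟩
    simp only at this hl
    rw [this] at hl
    have h1 : σ l ⟨x, hx⟩ = ⟨y, hy⟩ := Subtype.ext hl
    rw [← h1]
    simp [σ]

/-- The image of a block under a permutation of the points. -/
def Block.map {n r : ℕ} (σ : Equiv.Perm (Fin n)) (B : Block n r) : Block n r :=
  ⟨B.1.map σ.toEmbedding, by rw [Finset.card_map]; exact B.2⟩

lemma Block.mem_map {n r : ℕ} (σ : Equiv.Perm (Fin n)) (B : Block n r) (x : Fin n) :
    x ∈ (B.map σ).1 ↔ σ.symm x ∈ B.1 := by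
  simp [Block.map, Finset.mem_map_equiv]

/-- Any choice of `m` helpers per block is balanced by using all its `d` cyclic rotations of `A`,
one in each copy. -/
lemma exists_alloc {n d m : ℕ} (hd : 1 ≤ d) (hdn : d < n) :
    ∃ alloc : Fin d → (j : Fin n) → HelperSet n d j → Block n (m + (n - d)) → Finset (Fin n),
      (∀ l j A B, j ∈ B.1 → alloc l j A B ⊆ A.1 ∩ B.1) ∧
      (∀ l j A B, j ∈ B.1 → (alloc l j A B).card = m) ∧
      ∀ (j : Fin n) (A : HelperSet n d j), ∀ i ∈ A.1,
        Nat.card {p : Fin d × Block n (m + (n - d)) // j ∈ p.2.1 ∧ i ∈ alloc p.1 j A p.2} =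
          m * (n - 1).choose (m + (n - d) - 1) := by
  classical
  have h0 : ∀ (j : Fin n) (A : HelperSet n d j) (B : Block n (m + (n - d))),
      ∃ E : Finset (Fin n), j ∈ B.1 → E ⊆ A.1 ∩ B.1 ∧ E.card = m := by
    intro j A B
    by_cases hj : j ∈ B.1
    -- At most `n - d` of the `m + (n - d)` points of `B` lie outside `A`.
    · have h1 : m ≤ (A.1 ∩ B.1).card := by
        have h2 : (B.1 \ A.1).card + (A.1 ∩ B.1).card = B.1.card := by
          rw [Finset.inter_comm]
          exact Finset.card_sdiff_add_card_inter _ _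
        have h3 : (B.1 \ A.1).card ≤ (A.1ᶜ).card := by
          refine Finset.card_le_card fun x hx => ?_
          rw [Finset.mem_compl]
          exact (Finset.mem_sdiff.1 hx).2
        rw [Finset.card_compl, Fintype.card_fin, A.2.2] at h3
        have := B.2
        omega
      obtain ⟨E, hE, hEm⟩ := Finset.exists_subset_card_eq h1
      exact ⟨E, fun _ => ⟨hE, hEm⟩⟩
    · exact ⟨∅, fun h => (hj h).elim⟩
  choose a ha using h0
  have h1 := fun (j : Fin n) (A : HelperSet n d j) => exists_rotations hd A.1 A.2.2
  choose ρ hρfix hρmem hρuniq using h1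
  have hfixs : ∀ j A l, ∀ x ∉ A.1, (ρ j A l).symm x = x := by
    intro j A l x hx
    rw [Equiv.symm_apply_eq, hρfix j A l x hx]
  have hmems : ∀ j A l x, (ρ j A l).symm x ∈ A.1 ↔ x ∈ A.1 := by
    intro j A l x
    constructor
    · intro h
      simpa using hρmem j A l _ h
    · intro h
      by_contra hcon
      have := hρfix j A l _ hcon
      rw [Equiv.apply_symm_apply] at this
      exact hcon (this ▸ h)
  have hj : ∀ j A l (B : Block n (m + (n - d))), j ∈ B.1 ↔ j ∈ (B.map (ρ j A l).symm).1 := by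
    intro j A l B
    rw [Block.mem_map, Equiv.symm_symm, hρfix j A l j A.2.1]
  let alloc : Fin d → (j : Fin n) → HelperSet n d j → Block n (m + (n - d)) → Finset (Fin n) :=
    fun l j A B => (a j A (B.map (ρ j A l).symm)).map (ρ j A l).toEmbedding
  have hmem : ∀ l j A B x, x ∈ alloc l j A B ↔
      (ρ j A l).symm x ∈ a j A (B.map (ρ j A l).symm) := by
    intro l j A B x
    simp [alloc, Finset.mem_map_equiv]
  refine ⟨alloc, fun l j A B hB x hx => ?_, fun l j A B hB => ?_, fun j A i hi => ?_⟩
  · rw [hmem] at hx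
    have h2 := (ha j A _ ((hj j A l B).1 hB)).1 hx
    rw [Finset.mem_inter, hmems, Block.mem_map, Equiv.symm_symm, Equiv.apply_symm_apply] at h2
    exact Finset.mem_inter.2 h2
  · simp only [alloc, Finset.card_map]
    exact (ha j A _ ((hj j A l B).1 hB)).2
  -- Undoing the rotation sends `(l, B)` to a block `B'` and a helper `z` chosen for `B'`.
  -- Conversely `l` is the unique rotation taking `z` to `i`, so the count does not depend on `i`.
  · let f : {p : Fin d × Block n (m + (n - d)) // j ∈ p.2.1 ∧ i ∈ alloc p.1 j A p.2} →
        Σ B : {B : Block n (m + (n - d)) // j ∈ B.1}, {z // z ∈ a j A B.1} := fun p =>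
      ⟨⟨p.1.2.map (ρ j A p.1.1).symm, (hj j A _ _).1 p.2.1⟩,
        ⟨(ρ j A p.1.1).symm i, (hmem _ _ _ _ _).1 p.2.2⟩⟩
    have hf : Function.Bijective f := by
      constructor
      · rintro ⟨⟨l, B⟩, hp⟩ ⟨⟨l', B'⟩, hp'⟩ h
        have hz : (ρ j A l).symm i = (ρ j A l').symm i := by
          have := congrArg (fun q : Σ B : {B : Block n (m + (n - d)) // j ∈ B.1},
            {z // z ∈ a j A B.1} => q.2.1) h
          exact this
        have hB : B.map (ρ j A l).symm = B'.map (ρ j A l').symm := by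
          have := congrArg (fun q : Σ B : {B : Block n (m + (n - d)) // j ∈ B.1},
            {z // z ∈ a j A B.1} => q.1.1) h
          exact this
        have hl : l = l' := by
          refine (hρuniq j A ((ρ j A l).symm i) ((hmems j A l i).2 hi) i hi).unique ?_ ?_
          · simp
          · rw [hz]
            simp
        subst hl
        have hBB : B = B' := by
          apply Subtype.ext
          ext x
          have := congrArg (fun C : Block n (m + (n - d)) => (ρ j A l).symm x ∈ C.1) hB
          simpa [Block.mem_map] using this
        subst hBB
        rfl
      · rintro ⟨⟨B, hB⟩, ⟨z, hz⟩⟩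
        have hzA : z ∈ A.1 := (Finset.mem_inter.1 ((ha j A B hB).1 hz)).1
        obtain ⟨l, hl, -⟩ := hρuniq j A z hzA i hi
        have hBm : (B.map (ρ j A l)).map (ρ j A l).symm = B := by
          apply Subtype.ext
          ext x
          simp [Block.mem_map]
        have hzi : (ρ j A l).symm i = z := by rw [Equiv.symm_apply_eq, hl]
        refine ⟨⟨(l, B.map (ρ j A l)), ?_, ?_⟩, ?_⟩
        · rw [hj j A l, hBm]
          exact hB
        · rw [hmem, hBm, hzi]
          exact hz
        · refine Sigma.ext (Subtype.ext hBm) ?_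
          refine (Subtype.heq_iff_coe_eq fun x => ?_).2 hzi
          simp only [f, hBm]
    have hr : 1 ≤ m + (n - d) := by omega
    rw [Nat.card_congr (Equiv.ofBijective f hf), Nat.card_sigma]
    have h3 : ∀ B : {B : Block n (m + (n - d)) // j ∈ B.1},
        Nat.card {z // z ∈ a j A B.1} = m := by
      intro B
      simp [(ha j A B.1 B.2).2]
    simp only [h3, Finset.sum_const, Finset.card_univ, smul_eq_mul]
    rw [← Nat.card_eq_fintype_card, card_blocks_through hr, mul_comm]

/-! ### Erasures -/

section Erasures

variable {F : Type} [Field F]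

lemma IsMDS.eq_zero_of_place {n m s : ℕ} {P : Matrix (Fin s) (Fin m) F} (h : IsMDS P)
    {B : Finset (Fin n)} (place : {x // x ∈ B} ≃ Fin (m + s)) {J : Finset (Fin n)} (hJB : J ⊆ B)
    (hJ : m ≤ J.card) {u : Fin m → F}
    (hu : ∀ x : {x // x ∈ B}, x.1 ∈ J → systematic P u (place x) = 0) : u = 0 := by
  classical
  refine h.eq_zero (I := (J.subtype (· ∈ B)).map place.toEmbedding) ?_ fun i hi => ?_
  · rw [Finset.card_map, Finset.card_subtype, Finset.filter_true_of_mem fun x hx => hJB hx]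
    exact hJ
  · rw [Finset.mem_map_equiv, Finset.mem_subtype] at hi
    simpa using hu _ hi

/-- The part of the data array that belongs to the block `B`. -/
def blockData {n r m M T : ℕ} (hsize : M + T = n.choose r * m)
    (num : Block n r ≃ Fin (n.choose r)) (x : Fin (M + T) → F) (B : Block n r) : Fin m → F :=
  fun b => x (Fin.cast hsize.symm (finProdFinEquiv (num B, b)))

/-- The data arrays all of whose symbols outside the disks of `A` vanish. -/
def erased {n m s M T : ℕ} (hsize : M + T = n.choose (m + s) * m)
    (num : Block n (m + s) ≃ Fin (n.choose (m + s)))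
    (place : ∀ B : Block n (m + s), {x // x ∈ B.1} ≃ Fin (m + s))
    (P : Matrix (Fin s) (Fin m) F) (A : Finset (Fin n)) : Submodule F (Fin (M + T) → F) where
  carrier := {x | ∀ B (z : {z // z ∈ B.1}), z.1 ∉ A →
    systematic P (blockData hsize num x B) (place B z) = 0}
  zero_mem' := fun B z _ => congrFun ((systematicLin P).map_zero) (place B z)
  add_mem' := fun {x y} hx hy B z hz => by
    have h := congrFun ((systematicLin P).map_add (blockData hsize num x B)
      (blockData hsize num y B)) (place B z)
    refine h.trans ?_
    change systematic P _ _ + systematic P _ _ = 0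
    rw [hx B z hz, hy B z hz, add_zero]
  smul_mem' := fun c x hx B z hz => by
    have h := congrFun ((systematicLin P).map_smul c (blockData hsize num x B)) (place B z)
    refine h.trans ?_
    change c * systematic P _ _ = 0
    rw [hx B z hz, mul_zero]

lemma eq_zero_of_blockData {n r m M T : ℕ} (hsize : M + T = n.choose r * m)
    (num : Block n r ≃ Fin (n.choose r)) {x : Fin (M + T) → F}
    (h : ∀ B, blockData hsize num x B = 0) : x = 0 := by
  funext i
  obtain ⟨⟨y, b⟩, hy⟩ := finProdFinEquiv.surjective (Fin.cast hsize i)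
  have h1 := congrFun (h (num.symm y)) b
  simp only [blockData, Equiv.apply_symm_apply, hy] at h1
  exact h1

/-- The erasure of the disks in `A` leaves at most `lossOf A` dimensions undetermined. -/
lemma finrank_erased_le {n m s M T : ℕ} (hsize : M + T = n.choose (m + s) * m)
    (num : Block n (m + s) ≃ Fin (n.choose (m + s)))
    (place : ∀ B : Block n (m + s), {x // x ∈ B.1} ≃ Fin (m + s))
    {P : Matrix (Fin s) (Fin m) F} (hP : IsMDS P) (A : Finset (Fin n)) :
    Module.finrank F (erased hsize num place P A) ≤ lossOf n (m + s) (s + 1) A := by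
  classical
  -- Revealing `|B ∩ A| - s` erased symbols of `B` leaves at least `m` known symbols, which
  -- determine the block. Evaluation at these symbols is therefore injective on `erased`.
  have h0 : ∀ B : Block n (m + s), ∃ E ⊆ B.1 ∩ A, E.card = (B.1 ∩ A).card - s := fun B =>
    Finset.exists_subset_card_eq (Nat.sub_le _ _)
  choose E hE hEc using h0
  let ψ : (Fin (M + T) → F) →ₗ[F] ((Σ B : Block n (m + s), {z // z ∈ E B}) → F) :=
    { toFun := fun x q => systematicLin P (blockData hsize num x q.1)
        (place q.1 ⟨q.2.1, (Finset.mem_inter.1 (hE q.1 q.2.2)).1⟩)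
      map_add' := fun x y => by
        funext q
        exact congrFun ((systematicLin P).map_add (blockData hsize num x q.1)
          (blockData hsize num y q.1)) _
      map_smul' := fun c x => by
        funext q
        exact congrFun ((systematicLin P).map_smul c (blockData hsize num x q.1)) _ }
  have h1 := LinearMap.finrank_le_finrank_of_injective
    (f := ψ ∘ₗ (erased hsize num place P A).subtype) (by
      rw [← LinearMap.ker_eq_bot, LinearMap.ker_eq_bot']
      rintro ⟨x, hx⟩ hx2
      apply Subtype.ext
      refine eq_zero_of_blockData hsize num fun B => ?_
      refine hP.eq_zero_of_place (place B) (J := (B.1 \ A) ∪ E B) ?_ ?_ ?_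
      · exact Finset.union_subset Finset.sdiff_subset
          ((hE B).trans Finset.inter_subset_left)
      · rw [Finset.card_union_of_disjoint, hEc]
        · have h2 := Finset.card_sdiff_add_card_inter B.1 A
          have h3 := B.2
          omega
        · rw [Finset.disjoint_left]
          intro z hz hz'
          exact (Finset.mem_sdiff.1 hz).2 (Finset.mem_inter.1 (hE B hz')).2
      · intro z hz
        rcases Finset.mem_union.1 hz with hz | hz
        · exact hx B z (Finset.mem_sdiff.1 hz).2
        · exact congrFun hx2 ⟨B, ⟨z.1, hz⟩⟩)
  refine h1.trans ?_
  rw [Module.finrank_fintype_fun_eq_card, Fintype.card_sigma, lossOf_eq (by omega)]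
  rw [Finset.sum_subtype (p := fun B : Finset (Fin n) => B.card = m + s) _
    (by simp [Finset.mem_powersetCard])]
  refine Finset.sum_le_sum fun B _ => ?_
  rw [Fintype.card_coe, hEc]
  simp

end Erasures

/-! ### The code obtained from a complete block design -/

/-- Encoding and repair-encoding functions that determine the message and the repaired contents
can be completed to a code. -/
lemma exists_exactRepairCode {n k d N Nd K : ℕ} (hN : 1 ≤ N) (enc : Fin n → Fin N → Fin Nd)
    (repEnc : (j : Fin n) → (A : HelperSet n d j) → {i // i ∈ A.1} → Fin Nd → Fin K)
    (hdec : ∀ (A : NodeSet n k) w w', (∀ i ∈ A.1, enc i w = enc i w') → w = w')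
    (hrep : ∀ (j : Fin n) (A : HelperSet n d j) w w',
      (∀ i, repEnc j A i (enc i.1 w) = repEnc j A i (enc i.1 w')) → enc j w = enc j w') :
    ∃ C : ExactRepairCode n k d N Nd K, C.enc = enc ∧ C.repEnc = repEnc := by
  classical
  have w₀ : Fin N := ⟨0, hN⟩
  let dec : (A : NodeSet n k) → ({i // i ∈ A.1} → Fin Nd) → Fin N := fun A c =>
    if h : ∃ w, (fun i : {i // i ∈ A.1} => enc i.1 w) = c then h.choose else w₀
  let repDec : (j : Fin n) → (A : HelperSet n d j) → ({i // i ∈ A.1} → Fin K) → Fin Nd :=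
    fun j A c => if h : ∃ w, (fun i : {i // i ∈ A.1} => repEnc j A i (enc i.1 w)) = c
      then enc j h.choose else enc j w₀
  refine ⟨⟨enc, dec, repEnc, repDec, fun w A => ?_, fun w j A => ?_⟩, rfl, rfl⟩
  · have h : ∃ w', (fun i : {i // i ∈ A.1} => enc i.1 w') = fun i => enc i.1 w := ⟨w, rfl⟩
    simp only [dec, dif_pos h]
    exact hdec A _ _ fun i hi => congrFun h.choose_spec ⟨i, hi⟩
  · have h : ∃ w', (fun i : {i // i ∈ A.1} => repEnc j A i (enc i.1 w')) =
        fun i => repEnc j A i (enc i.1 w) := ⟨w, rfl⟩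
    simp only [repDec, dif_pos h]
    exact hrep j A _ _ fun i => congrFun h.choose_spec i

namespace DesignCode

variable {F : Type} [Field F] {n k d m M L : ℕ}

/-- In each copy, the difference of two messages agreeing on the disks of `A` encodes to an array
erased by the `n - k` disks of the complement. -/
lemma eq_of_stored_eq (X : DesignCode F n k d m M L)
    (hX : ∀ A : Finset (Fin n), A.card = n - k → ∀ v,
      systematic X.S v ∈ erased X.size X.num X.place X.P A → v = 0)
    (A : NodeSet n k) {v v' : Fin L → Fin M → F}
    (h : ∀ i ∈ A.1, X.stored i v = X.stored i v') : v = v' := by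
  funext l
  rw [← sub_eq_zero]
  refine hX A.1ᶜ (by rw [Finset.card_compl, Fintype.card_fin, A.2]) _ fun B z hz => ?_
  rw [Finset.mem_compl, not_not] at hz
  have h1 := congrFun (congrFun (h z.1 hz) l) ⟨B, z.2⟩
  have h2 : blockData X.size X.num (systematic X.S (v l - v' l)) B =
      X.data (v l) B - X.data (v' l) B := by
    rw [systematic_sub]
    rfl
  rw [h2, systematic_sub, Pi.sub_apply, sub_eq_zero]
  exact h1

lemma stored_eq_of_sent_eq (X : DesignCode F n k d m M L) (j : Fin n) (A : HelperSet n d j)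
    {v v' : Fin L → Fin M → F}
    (h : ∀ i ∈ A.1, X.sent j A i (X.stored i v) = X.sent j A i (X.stored i v')) :
    X.stored j v = X.stored j v' := by
  funext l B
  have h1 : X.data (v l) B.1 - X.data (v' l) B.1 = 0 := by
    refine X.mds.eq_zero_of_place (X.place B.1) (J := X.alloc l j A B.1)
      ((X.alloc_sub l j A B.1 B.2).trans Finset.inter_subset_right)
      (X.alloc_card l j A B.1 B.2).ge fun x hx => ?_
    rw [systematic_sub, Pi.sub_apply, sub_eq_zero]
    exact congrFun (h x.1 (Finset.mem_inter.1 (X.alloc_sub l j A B.1 B.2 hx)).1)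
      ⟨(l, B.1), B.2, hx⟩
  rw [sub_eq_zero] at h1
  simp only [stored, symbol, h1]

/-- Passage from field symbols to numbered alphabets. Only `Nat.card F ^ β ≤ K` is required, which
leaves room for wasted bandwidth. -/
lemma exists_isDesignCode [Finite F] (X : DesignCode F n k d m M L)
    (hX : ∀ A : Finset (Fin n), A.card = n - k → ∀ v,
      systematic X.S v ∈ erased X.size X.num X.place X.P A → v = 0)
    {β K : ℕ} (hβ : ∀ (j : Fin n) (A : HelperSet n d j), ∀ i ∈ A.1,
      Nat.card {p : Fin L × Block n (m + (n - d)) // j ∈ p.2.1 ∧ i ∈ X.alloc p.1 j A p.2} ≤ β)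
    (hK : Nat.card F ^ β ≤ K) :
    ∃ C : ExactRepairCode n k d ((Nat.card F ^ M) ^ L)
        ((Nat.card F ^ ((n - 1).choose (m + (n - d) - 1))) ^ L) K, IsDesignCode _ _ K C := by
  have hr : 1 ≤ m + (n - d) := by
    have := X.one_le_m
    omega
  let msg : Fin ((Nat.card F ^ M) ^ L) ≃ (Fin L → Fin M → F) :=
    (Finite.equivFinOfCardEq (by simp [Nat.card_fun])).symm
  let disk : ∀ i : Fin n, Fin ((Nat.card F ^ ((n - 1).choose (m + (n - d) - 1))) ^ L) ≃
      (Fin L → {B : Block n (m + (n - d)) // i ∈ B.1} → F) := fun i =>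
    (Finite.equivFinOfCardEq (by
      rw [Nat.card_fun, Nat.card_fun, card_blocks_through hr, Nat.card_fin])).symm
  have htx : ∀ (j : Fin n) (A : HelperSet n d j) (i : {i // i ∈ A.1}),
      ∃ tx : ({p : Fin L × Block n (m + (n - d)) //
          j ∈ p.2.1 ∧ i.1 ∈ X.alloc p.1 j A p.2} → F) → Fin K, Function.Injective tx := by
    intro j A i
    have hcard : Nat.card ({p : Fin L × Block n (m + (n - d)) //
          j ∈ p.2.1 ∧ i.1 ∈ X.alloc p.1 j A p.2} → F) ≤ K := by
      rw [Nat.card_fun]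
      exact (Nat.pow_le_pow_right Nat.card_pos (hβ j A i.1 i.2)).trans hK
    exact ⟨fun y => Fin.castLE hcard (Finite.equivFin _ y),
      (Fin.castLE_injective hcard).comp (Equiv.injective _)⟩
  choose tx htx using htx
  obtain ⟨C, hC1, hC2⟩ := exists_exactRepairCode (k := k) (d := d) (K := K)
    (Nat.pos_of_ne_zero (by simp [Nat.card_pos.ne']))
    (fun i w => (disk i).symm (X.stored i (msg w)))
    (fun j A i y => tx j A i (X.sent j A i.1 (disk i.1 y)))
    (fun A w w' h => by
      refine msg.injective (X.eq_of_stored_eq hX A fun i hi => ?_)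
      exact (disk i).symm.injective (h i hi))
    (fun j A w w' h => by
      congr 1
      refine X.stored_eq_of_sent_eq j A fun i hi => ?_
      have := htx j A ⟨i, hi⟩ (h ⟨i, hi⟩)
      simpa using this)
  refine ⟨C, F, inferInstance, inferInstance, m, M, L, X, msg, disk, fun i w => ?_,
    fun j A i => ⟨tx j A i, htx j A i, fun y => ?_⟩⟩
  · rw [hC1, Equiv.apply_symm_apply]
  · rw [hC2]

end DesignCode

/-- Over every large enough field, `d` copies of the complete block design code exist, in which
every helper sends `m * choose (n - 1) (r - 1)` symbols. -/
lemma exists_designCode {F : Type} [Field F] [Finite F] {n k d m : ℕ} (hd : 1 ≤ d) (hdn : d < n)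
    (hm : 1 ≤ m) (hmn : m + (n - d) ≤ n) (hF : 2 ^ n + 1 < Nat.card F) :
    ∃ X : DesignCode F n k d m
        (n.choose (m + (n - d)) * m - loss n k (m + (n - d)) (n - d + 1)) d,
      (∀ A : Finset (Fin n), A.card = n - k → ∀ v,
        systematic X.S v ∈ erased X.size X.num X.place X.P A → v = 0) ∧
      ∀ (j : Fin n) (A : HelperSet n d j), ∀ i ∈ A.1,
        Nat.card {p : Fin d × Block n (m + (n - d)) // j ∈ p.2.1 ∧ i ∈ X.alloc p.1 j A p.2} =
          m * (n - 1).choose (m + (n - d) - 1) := by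
  obtain ⟨P, hP, hP1⟩ := exists_isMDS (F := F) (m := m) (s := n - d)
    (lt_of_le_of_lt (Nat.add_le_add_right (Nat.pow_le_pow_right (by norm_num) hmn) 1) hF)
  obtain ⟨alloc, h1, h2, h3⟩ := exists_alloc (m := m) hd hdn
  have hsize : n.choose (m + (n - d)) * m - loss n k (m + (n - d)) (n - d + 1) +
      loss n k (m + (n - d)) (n - d + 1) = n.choose (m + (n - d)) * m :=
    Nat.sub_add_cancel loss_le_mul
  let num : Block n (m + (n - d)) ≃ Fin (n.choose (m + (n - d))) :=
    Finite.equivFinOfCardEq (card_block _ _)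
  let place : ∀ B : Block n (m + (n - d)), {x // x ∈ B.1} ≃ Fin (m + (n - d)) := fun B =>
    Finset.equivFinOfCardEq B.2
  obtain ⟨S, hS⟩ := exists_systematic (ι := {A : Finset (Fin n) // A.card = n - k})
    (fun A => erased hsize num place P A.1)
    (fun A => (finrank_erased_le hsize num place hP A.1).trans
      (Finset.le_sup (f := lossOf n (m + (n - d)) (n - d + 1))
        (Finset.mem_powersetCard.2 ⟨Finset.subset_univ _, A.2⟩))) (by
        refine lt_of_le_of_lt (Nat.add_le_add_right ?_ 1) hF
        refine (Finite.card_subtype_le _).trans ?_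
        simp)
  exact ⟨⟨hm, hmn, hd, hsize, num, place, P, hP, hP1, S, alloc, h1, h2,
    fun j A i hi i' hi' => by rw [h3 j A i hi, h3 j A i' hi']⟩, fun A hA v hv => hS ⟨A, hA⟩ v hv,
    h3⟩

/-- The normalized pairs of the complete block design codes are achievable, even after wasting an
arbitrary proportion of the repair bandwidth. -/
lemma achievableByDesign {n k d m : ℕ} (hd : 1 ≤ d) (hdn : d < n) (hm : 1 ≤ m)
    (hmn : m + (n - d) ≤ n) {c a Q : ℝ} (hc : 0 < c) (hc1 : c ≤ 1) (ha : c * (d / m) ≤ a)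
    (hQ : Q ≤ c * (d * (n.choose (m + (n - d)) * m - loss n k (m + (n - d)) (n - d + 1)) /
      (m * (n - 1).choose (m + (n - d) - 1)))) :
    AchievableByDesign n k d a Q := by
  intro ε hε
  set r := m + (n - d) with hr
  set b := (n - 1).choose (r - 1) with hb
  set M := n.choose r * m - loss n k r (n - d + 1) with hM
  have hb0 : 0 < b := Nat.choose_pos (by omega)
  have hmb : (0 : ℝ) < m * b := by
    have : (0 : ℝ) < m := by exact_mod_cast hm
    positivity
  have hMcast : (M : ℝ) = n.choose r * m - loss n k r (n - d + 1) := by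
    rw [hM, Nat.cast_sub loss_le_mul]
    push_cast
    rfl
  rw [← hMcast] at hQ
  -- the repair bandwidth that is paid for, in symbols
  set s : ℝ := m * b / c with hs
  have hs0 : 0 < s := by positivity
  have hmbs : (m * b : ℝ) ≤ s := by
    rw [hs, le_div_iff₀ hc]
    nlinarith
  -- a large prime field
  have hlim : Tendsto (fun q : ℕ => (d * M : ℝ) / (s + Real.log 2 / Real.log q)) atTop
      (nhds ((d * M : ℝ) / (s + 0))) := by
    refine tendsto_const_nhds.div (tendsto_const_nhds.add ?_) (by linarith)
    exact tendsto_const_nhds.div_atTop (Real.tendsto_log_atTop.comp tendsto_natCast_atTop_atTop)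
  have hev := (hlim.eventually_const_le (u := (d * M : ℝ) / (s + 0) - ε) (by linarith)).and
    (eventually_ge_atTop (2 ^ n + 2))
  obtain ⟨q₀, hq₀⟩ := eventually_atTop.1 hev
  obtain ⟨q, hq, hqp⟩ := Nat.exists_infinite_primes q₀
  obtain ⟨hq1, hq2⟩ := hq₀ q hq
  have : Fact q.Prime := ⟨hqp⟩
  have hqcard : Nat.card (ZMod q) = q := Nat.card_zmod q
  obtain ⟨X, hX, hβ⟩ := exists_designCode (F := ZMod q) (k := k) hd hdn hm hmn
    (by rw [hqcard]; omega)
  have hq1' : (1 : ℝ) < q := by exact_mod_cast hqp.one_lt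
  have hlogq : 0 < Real.log q := Real.log_pos hq1'
  have hqs : (q : ℝ) ^ (m * b) ≤ (q : ℝ) ^ s := by
    rw [← Real.rpow_natCast]
    refine Real.rpow_le_rpow_of_exponent_le hq1'.le ?_
    push_cast
    exact hmbs
  -- Rounding `q ^ s` up costs at most `log 2` in `log K`, which is negligible against `log q`: the
  -- error term in `hlim`.
  set K := ⌈(q : ℝ) ^ s⌉₊ with hK
  have hKq : (q : ℝ) ^ s ≤ K := Nat.le_ceil _
  have hKβ : q ^ (m * b) ≤ K := by exact_mod_cast hqs.trans hKq
  have hmb1 : m * b ≠ 0 := by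
    have : 0 < m * b := Nat.mul_pos hm hb0
    omega
  have hK2 : 2 ≤ K := hqp.two_le.trans ((Nat.le_self_pow hmb1 q).trans hKβ)
  have hlogK1 : s * Real.log q ≤ Real.log K := by
    rw [← Real.log_rpow (by linarith)]
    exact Real.log_le_log (by positivity) hKq
  have hlogK2 : Real.log K ≤ s * Real.log q + Real.log 2 := by
    have h1 : (1 : ℝ) ≤ (q : ℝ) ^ s := Real.one_le_rpow hq1'.le hs0.le
    have h2 : (K : ℝ) ≤ (q : ℝ) ^ s * 2 := by
      have := (Nat.ceil_lt_add_one (by positivity : 0 ≤ (q : ℝ) ^ s)).le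
      linarith
    rw [← Real.log_rpow (by linarith), ← Real.log_mul (by positivity) (by norm_num)]
    exact Real.log_le_log (by positivity) h2
  have hlogK0 : 0 < Real.log K := lt_of_lt_of_le (by positivity) hlogK1
  obtain ⟨C, hC⟩ := X.exists_isDesignCode hX (β := m * b) (K := K)
    (fun j A i hi => (hβ j A i hi).le) (by rw [hqcard]; exact hKβ)
  refine ⟨_, _, K, C, hC, ?_, hK2, ?_, ?_⟩
  · exact Nat.pos_of_ne_zero (by simp [hqp.ne_zero])
  · rw [hqcard]
    push_cast
    rw [Real.log_pow, Real.log_pow, div_le_iff₀ hlogK0]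
    have h1 : (d : ℝ) * b ≤ a * s := by
      calc (d : ℝ) * b = c * (d / m) * s := by
            rw [hs]
            have : (m : ℝ) ≠ 0 := by positivity
            field_simp
        _ ≤ a * s := by gcongr
    have ha0 : 0 ≤ a := le_trans (by positivity) ha
    calc (d : ℝ) * (b * Real.log q) = (d * b) * Real.log q := by ring
      _ ≤ (a * s) * Real.log q := by gcongr
      _ = a * (s * Real.log q) := by ring
      _ ≤ (a + ε) * Real.log K := by gcongr; linarith
  · rw [hqcard]
    push_cast
    rw [Real.log_pow, Real.log_pow]
    have h1 : (d * M : ℝ) / (s + Real.log 2 / Real.log q) ≤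
        d * (M * Real.log q) / Real.log K := by
      have h2 : (d * M : ℝ) / (s + Real.log 2 / Real.log q) =
          d * (M * Real.log q) / (s * Real.log q + Real.log 2) := by
        have : (0 : ℝ) < s * Real.log q + Real.log 2 := by positivity
        field_simp
      rw [h2]
      gcongr
    have h3 : Q ≤ (d * M : ℝ) / (s + 0) := by
      refine hQ.trans (le_of_eq ?_)
      rw [hs, add_zero]
      field_simp
    linarith

/-! ### The exponents of the complete block design codes -/

/-- The normalized message size of the complete block design code, and its redundancy. -/
lemma design_bounds {τ₁ τ₂ n m : ℕ} (hτ₂ : 1 ≤ τ₂) (hτ : τ₂ ≤ τ₁) (hn : 2 * τ₁ < n)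
    (hm : 1 ≤ m) (hmn : m + τ₂ ≤ n) {D Q : ℝ} (hD : D = ((n - τ₂ : ℕ) : ℝ) / m)
    (hQ : Q = (n - τ₂ : ℕ) * (n.choose (m + τ₂) * m - loss n (n - τ₁) (m + τ₂) (τ₂ + 1)) /
      (m * (n - 1).choose (m + τ₂ - 1))) :
    n * D - Q ≤ (τ₂ + τ₁ ^ 2 * (1 + τ₂)) * n ^ 2 / m ^ 2 ∧
    (n : ℝ) ^ 2 / (2 * m) ≤ n * D := by
  have hd : ((n - τ₂ : ℕ) : ℝ) = n - τ₂ := by rw [Nat.cast_sub (by omega)]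
  have hn2 : 2 * (τ₁ : ℝ) ≤ n := by exact_mod_cast hn.le
  have ht : (τ₂ : ℝ) ≤ τ₁ := by exact_mod_cast hτ
  have ht2 : (1 : ℝ) ≤ τ₂ := by exact_mod_cast hτ₂
  have hm1 : (1 : ℝ) ≤ m := by exact_mod_cast hm
  have hmn' : (m : ℝ) ≤ n := by exact_mod_cast (by omega : m ≤ n)
  have hmpos : (0 : ℝ) < m := by linarith
  have hnpos : (0 : ℝ) < n := by linarith
  set T := loss n (n - τ₁) (m + τ₂) (τ₂ + 1) with hT
  set d : ℝ := ((n - τ₂ : ℕ) : ℝ) with hddef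
  set b := (n - 1).choose (m + τ₂ - 1) with hb
  set b' := (n - 2).choose (m + τ₂ - 2) with hb'
  have hbpos : (0 : ℝ) < b := by exact_mod_cast Nat.choose_pos (by omega)
  have hchoose : (n : ℝ) * b = n.choose (m + τ₂) * (m + τ₂) := by
    have h := Nat.add_one_mul_choose_eq (n - 1) (m + τ₂ - 1)
    rw [show n - 1 + 1 = n by omega, show m + τ₂ - 1 + 1 = m + τ₂ by omega] at h
    exact_mod_cast h
  have hchoose' : ((n : ℝ) - 1) * b' = b * (m + τ₂ - 1) := by
    have h := Nat.add_one_mul_choose_eq (n - 2) (m + τ₂ - 2)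
    rw [show n - 2 + 1 = n - 1 by omega, show m + τ₂ - 2 + 1 = m + τ₂ - 1 by omega] at h
    have h' : (((n - 1 : ℕ) : ℝ)) * b' = b * ((m + τ₂ - 1 : ℕ) : ℝ) := by exact_mod_cast h
    rw [Nat.cast_sub (by omega), Nat.cast_sub (by omega)] at h'
    push_cast at h'
    exact h'
  have hTle : (T : ℝ) ≤ τ₁ ^ 2 * b' := by
    have h1 : T ≤ τ₁ ^ 2 * b' := by
      refine (loss_le (by omega) (by omega)).trans (Nat.mul_le_mul_right _ ?_)
      rw [show n - (n - τ₁) = τ₁ by omega]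
      exact Nat.choose_le_pow τ₁ 2
    exact_mod_cast h1
  -- By `hchoose'`, `b' / b` is about `m / n`, which absorbs the factor `d`; so the contribution `d
  -- * T / (m * b)` stays bounded.
  have hdT : d * T ≤ τ₁ ^ 2 * (1 + τ₂) * (m * b) := by
    have h1 : (0 : ℝ) ≤ b' := by positivity
    calc d * T ≤ (n - 1) * (τ₁ ^ 2 * b') := by
          rw [hd]
          gcongr
          linarith
      _ = τ₁ ^ 2 * (b * (m + τ₂ - 1)) := by rw [← hchoose']; ring
      _ ≤ τ₁ ^ 2 * (b * ((1 + τ₂) * m)) := by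
          gcongr
          nlinarith
      _ = _ := by ring
  constructor
  -- The redundancy is that of the local parities plus that of the long code.
  · have hsplit : n * D - Q = d * n * τ₂ / (m * (m + τ₂)) + d * T / (m * b) := by
      have hch : (n.choose (m + τ₂) : ℝ) = n * b / (m + τ₂) := by
        rw [hchoose]
        field_simp
      rw [hD, hQ, hch]
      field_simp
      ring
    have h1 : d * n * τ₂ / (m * (m + τ₂)) ≤ τ₂ * n ^ 2 / m ^ 2 := by
      have : d * n * τ₂ ≤ τ₂ * n ^ 2 := by
        have : d * (n * τ₂) ≤ n * (n * τ₂) := by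
          gcongr
          linarith
        linarith
      gcongr
      nlinarith
    have h2 : d * T / (m * b) ≤ τ₁ ^ 2 * (1 + τ₂) * n ^ 2 / m ^ 2 := by
      have h3 : d * T / (m * b) ≤ τ₁ ^ 2 * (1 + τ₂) := by
        rw [div_le_iff₀ (by positivity)]
        exact hdT
      refine h3.trans ?_
      rw [le_div_iff₀ (by positivity)]
      gcongr
    rw [hsplit, add_mul, add_div]
    exact add_le_add h1 h2
  · rw [hD, mul_div_assoc', div_le_div_iff₀ (by positivity) hmpos]
    have : (n : ℝ) * (n * m) ≤ n * (2 * d * m) := by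
      gcongr
      linarith
    linarith

/-- Lowering `E_d` makes all three inequalities strict. -/
lemma exists_strict_near {p : ℝ × ℝ} (hp : p ∈ Estar) {ε : ℝ} (hε : 0 < ε) :
    ∃ q : ℝ × ℝ, dist q p < ε ∧ q.2 < q.1 + 1 ∧ 2 * q.2 < 2 + q.1 ∧ q.2 < 2 := by
  obtain ⟨h1, h2, h3⟩ := hp
  refine ⟨(p.1, p.2 - ε / 2), ?_, by simp only; linarith, by simp only; linarith,
    by simp only; linarith⟩
  rw [Prod.dist_eq]
  simp only [dist_self, Real.dist_eq]
  rw [show p.2 - ε / 2 - p.2 = -(ε / 2) by ring, abs_neg, abs_of_pos (by positivity)]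
  exact max_lt hε (by linarith)

lemma eventually_mul_rpow_le {x y : ℝ} (c : ℝ) (h : y < x) :
    ∀ᶠ n : ℕ in atTop, c * (n : ℝ) ^ y ≤ (n : ℝ) ^ x := by
  have h1 : Tendsto (fun n : ℕ => (n : ℝ) ^ (x - y)) atTop atTop :=
    (tendsto_rpow_atTop (by linarith)).comp tendsto_natCast_atTop_atTop
  filter_upwards [h1.eventually_ge_atTop c, eventually_gt_atTop 0] with n h2 h3
  have hn0 : (0 : ℝ) < n := by exact_mod_cast h3
  rw [Real.rpow_sub hn0, le_div_iff₀ (by positivity)] at h2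
  exact h2

/-- In the interior of the region, the complete block design codes with block size about `n ^ ρ`
are good enough. -/
lemma eventually_achievableByDesign {τ₁ τ₂ : ℕ} (hτ₂ : 1 ≤ τ₂) (hτ : τ₂ ≤ τ₁) {x y : ℝ}
    (h1 : y < x + 1) (h2 : 2 * y < 2 + x) (h3 : y < 2) :
    ∀ᶠ n : ℕ in atTop, AchievableByDesign n (n - τ₁) (n - τ₂)
      (((n : ℝ) ^ x + (n : ℝ) ^ y) / n) ((n : ℝ) ^ y) := by
  -- The message needs `ρ < 2 - y`, the redundancy `ρ > y - x`, the block size `0 < ρ < 1`. Such a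
  -- `ρ` exists exactly under the three strict inequalities.
  obtain ⟨ρ, hρ1, hρ2⟩ : ∃ ρ, max 0 (y - x) < ρ ∧ ρ < min 1 (2 - y) :=
    exists_between (max_lt (lt_min one_pos (by linarith)) (lt_min (by linarith) (by linarith)))
  obtain ⟨hρ0, hρxy⟩ := max_lt_iff.1 hρ1
  obtain ⟨hρ1, hρy⟩ := lt_min_iff.1 hρ2
  set c₀ : ℝ := τ₂ + τ₁ ^ 2 * (1 + τ₂) with hc₀
  have hc₀0 : 0 ≤ c₀ := by positivity
  filter_upwards [eventually_mul_rpow_le (4 * c₀) hρ0, eventually_mul_rpow_le (2 + τ₂) hρ1,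
    eventually_mul_rpow_le 8 (show y < 2 - ρ by linarith),
    eventually_mul_rpow_le (4 * c₀) (show y - ρ < x by linarith),
    eventually_gt_atTop (2 * τ₁)] with n e1 e2 e3 e4 e5
  have hn1 : (1 : ℝ) ≤ n := by exact_mod_cast (by omega : 1 ≤ n)
  have hn0 : (0 : ℝ) < n := by linarith
  have hnρ : (1 : ℝ) ≤ (n : ℝ) ^ ρ := Real.one_le_rpow hn1 hρ0.le
  set m := ⌈(n : ℝ) ^ ρ⌉₊ with hm
  have hm1 : (n : ℝ) ^ ρ ≤ m := Nat.le_ceil _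
  have hm2 : (m : ℝ) ≤ 2 * (n : ℝ) ^ ρ := by
    have := (Nat.ceil_lt_add_one (by linarith : 0 ≤ (n : ℝ) ^ ρ)).le
    linarith
  have hm0 : 1 ≤ m := by exact_mod_cast hnρ.trans hm1
  have hmpos : (0 : ℝ) < m := by linarith
  have hmn : m + τ₂ ≤ n := by
    have ht : (0 : ℝ) ≤ τ₂ := by positivity
    have : (m + τ₂ : ℝ) ≤ n := by
      rw [Real.rpow_one] at e2
      nlinarith
    exact_mod_cast this
  obtain ⟨b1, b2⟩ := design_bounds hτ₂ hτ e5 hm0 hmn rfl rfl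
  set D : ℝ := ((n - τ₂ : ℕ) : ℝ) / m with hD
  set Q : ℝ := (n - τ₂ : ℕ) * (n.choose (m + τ₂) * m - loss n (n - τ₁) (m + τ₂) (τ₂ + 1)) /
      (m * (n - 1).choose (m + τ₂ - 1)) with hQ
  rw [← hc₀] at b1
  -- redundancy and message size in terms of `m`
  have hQ1 : (n : ℝ) ^ 2 / (4 * m) ≤ Q := by
    have h4 : c₀ * n ^ 2 / m ^ 2 ≤ (n : ℝ) ^ 2 / (4 * m) := by
      rw [div_le_div_iff₀ (by positivity) (by positivity)]
      have h5 : 4 * c₀ ≤ m := by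
        rw [Real.rpow_zero] at e1
        linarith
      have h6 : (0 : ℝ) ≤ n ^ 2 * m := by positivity
      have := mul_le_mul_of_nonneg_right h5 h6
      linarith
    have h7 : (n : ℝ) ^ 2 / (2 * m) = (n : ℝ) ^ 2 / (4 * m) + (n : ℝ) ^ 2 / (4 * m) := by
      field_simp
      norm_num
    linarith
  have hQ0 : 0 < Q := lt_of_lt_of_le (by positivity) hQ1
  have hny : 0 < (n : ℝ) ^ y := by positivity
  have hyQ : (n : ℝ) ^ y ≤ Q := by
    refine le_trans ?_ hQ1
    rw [le_div_iff₀ (by positivity)]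
    calc (n : ℝ) ^ y * (4 * m) ≤ (n : ℝ) ^ y * (4 * (2 * (n : ℝ) ^ ρ)) := by gcongr
      _ = 8 * (n : ℝ) ^ y * (n : ℝ) ^ ρ := by ring
      _ ≤ (n : ℝ) ^ (2 - ρ) * (n : ℝ) ^ ρ := by gcongr
      _ = (n : ℝ) ^ 2 := by rw [← Real.rpow_add hn0, sub_add_cancel, Real.rpow_two]
  have hred : (n : ℝ) ^ y / Q * (n * D - Q) ≤ (n : ℝ) ^ x := by
    calc (n : ℝ) ^ y / Q * (n * D - Q) ≤ (n : ℝ) ^ y / Q * (c₀ * n ^ 2 / m ^ 2) := by gcongr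
      _ ≤ (n : ℝ) ^ y / ((n : ℝ) ^ 2 / (4 * m)) * (c₀ * n ^ 2 / m ^ 2) := by gcongr
      _ = 4 * c₀ * ((n : ℝ) ^ y / m) := by field_simp
      _ ≤ 4 * c₀ * ((n : ℝ) ^ y / (n : ℝ) ^ ρ) := by gcongr
      _ = 4 * c₀ * (n : ℝ) ^ (y - ρ) := by rw [Real.rpow_sub hn0]
      _ ≤ (n : ℝ) ^ x := e4
  have hsub : n - (n - τ₂) = τ₂ := by omega
  -- This `c` scales the message to exactly `n ^ y`; the redundancy becomes at most `n ^ x`, and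
  -- extra storage makes up the difference.
  refine achievableByDesign (m := m) (c := (n : ℝ) ^ y / Q) (by omega) (by omega) hm0
    (by rw [hsub]; exact hmn) (by positivity) ((div_le_one hQ0).2 hyQ) ?_ ?_
  · rw [le_div_iff₀ hn0]
    have : (n : ℝ) ^ y / Q * Q = (n : ℝ) ^ y := div_mul_cancel₀ _ hQ0.ne'
    linear_combination hred + this
  · rw [hsub, ← hQ, div_mul_cancel₀ _ hQ0.ne']

lemma Estar_subset_exponentRegion_design {τ₁ τ₂ : ℕ} (hτ₂ : 1 ≤ τ₂) (hτ : τ₂ ≤ τ₁) :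
    Estar ⊆ exponentRegion AchievableByDesign τ₁ τ₂ := by
  intro p hp
  refine Metric.mem_closure_iff.2 fun ε hε => ?_
  obtain ⟨q, hq, h1, h2, h3⟩ := exists_strict_near hp hε
  refine ⟨q, ?_, by rwa [dist_comm]⟩
  rw [Filter.mem_limsup_iff_frequently_mem]
  refine Eventually.frequently ?_
  filter_upwards [eventually_achievableByDesign hτ₂ hτ h1 h2 h3, eventually_ge_atTop 2]
    with n h4 h5
  exact (mem_exponentPairs_iff h5).2 h4

end Regenerating

end

theorem mainTheorem1 (τ₁ τ₂ : ℕ) (hτ₂ : 1 ≤ τ₂) (hτ : τ₂ ≤ τ₁) :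
    Regenerating.exponentRegion Regenerating.Achievable τ₁ τ₂ = Regenerating.Estar ∧
    Regenerating.exponentRegion Regenerating.AchievableByDesign τ₁ τ₂ = Regenerating.Estar ∧
    Regenerating.exponentRegion Regenerating.TimeSharing τ₁ τ₂ ⊂ Regenerating.Estar := by
  have h1 : Regenerating.exponentRegion Regenerating.Achievable τ₁ τ₂ ⊆ Regenerating.Estar :=
    Regenerating.exponentRegion_subset_Estar hτ₂ hτ fun _ _ _ _ _ h => h.cutSet
  have h2 : Regenerating.exponentRegion Regenerating.AchievableByDesign τ₁ τ₂ ⊆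
      Regenerating.Estar :=
    Regenerating.exponentRegion_subset_Estar hτ₂ hτ fun _ _ _ _ _ h =>
      (Regenerating.AchievableIn.achievable h).cutSet
  have h3 := Regenerating.Estar_subset_exponentRegion_design hτ₂ hτ
  refine ⟨h1.antisymm ?_, h2.antisymm h3,
    Regenerating.exponentRegion_timeSharing_ssubset hτ₂ hτ⟩
  -- Design codes are codes, so their region gives the lower bound for arbitrary codes too.
  refine h3.trans (closure_mono fun p hp => ?_)
  rw [Filter.mem_limsup_iff_frequently_mem] at hp ⊢
  refine hp.mono fun n => ?_
  rintro ⟨a, M, h, h'⟩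
  exact ⟨a, M, Regenerating.AchievableIn.achievable h, h'⟩
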